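/- Let $d\ge 1$ be an integer, let $\phi=\frac{1+\sqrt5}{2}$, and let $\phi+1<\tau<3$ and $\alpha>\frac{\tau-1}{\tau-2}$ be real. Then there are $\rho_1,\rho_2>0$, depending only on $d,\tau,\alpha$, such that the following holds. Let $0<\theta_1\le\theta_2\le 1$, and let $\mathcal D$ be a power-law distribution on $[1,\infty)$ with exponent $\tau$, i.e. $\mathcal D$ either has a density $f$ on $[1,\infty)$ with $f(x)=\Theta(x^{-\tau})$ as $x\to\infty$, or is supported on the positive integers with $\mathcal D(\{k\})=\Theta(k^{-\tau})$ as $k\to\infty$. For each $n\in\mathbb N$ let $\mathcal G_n$ be the Euclidean GIRG defined as follows. The vertex set $\mathcal V$ is a Poisson point process of intensity $n$ on the torus $\mathbb T^d=\mathbb R^d/\mathbb Z^d$ (the number of vertices is Poisson with mean $n$, and the positions $x_v$ are i.i.d. uniform); every vertex $v$ draws an independent weight $W_v\sim\mathcal D$; and, given positions and weights, any two distinct vertices $u,v$ are joined by an edge, independently over pairs, with probability $p_{uv}=p_n(x_u,x_v,W_u,W_v)$, where $p_n$ is measurable and symmetric under exchanging $u$ and $v$, and $$\theta_1 m\le p_{uv}\le\theta_2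 m,\qquad m=\min\Big\{\Big(\frac{W_uW_v}{n\,V(|x_u-x_v|_\infty)}\Big)^{\alpha},1\Big\}.$$ Here $|\cdot|_\infty$ is the $\infty$-norm on $\mathbb T^d$ and $V(r)$ is the volume of the $\infty$-norm ball of radius $r$ in $\mathbb T^d$. In the synchronous push-pull protocol on $\mathcal G_n$ started at $s\in\mathcal V$, only $s$ is informed initially; in each round every non-isolated vertex chooses a neighbour uniformly at random (independently over vertices and rounds), and every vertex that chooses, or is chosen by, a vertex that was informed before the round becomes informed. Then there is a constant $C>0$, not depending on $n$, such that, with probability tending to $1$ as $n\to\infty$, for every starting vertex $s\in\mathcal V$ at most $C\,n^{1-\rho_1}$ vertices are informed after $\lfloor n^{\rho_2}\rfloor$ rounds. (All starting vertices use the same choices of neighbours, so the starting vertex may depend on the graph and on the protocol.) -/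

import Mathlib

open MeasureTheory Filter Topology
open scoped NNReal ENNReal

namespace GIRG

/-- The `d`-dimensional torus `ℝ^d / ℤ^d`. The norm on `UnitAddCircle = ℝ / ℤ` of the class of a
real `t` with `|t| ≤ 1` is `min |t| (1 - |t|)`, and the norm on the (finite) product is the maximum of the
coordinate norms, so `‖x - y‖` is the `∞`-distance on the torus. Its `volume` is the uniform
probability measure. -/
abbrev Torus (d : ℕ) : Type := Fin d → UnitAddCircle

instance : IsProbabilityMeasure (volume : Measure UnitAddCircle) :=
  ⟨UnitAddCircle.measure_univ⟩

/-- The volume of a ball of radius `r` in the `∞`-norm of the torus. -/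
noncomputable def ballVolume (d : ℕ) (r : ℝ) : ℝ :=
  (volume : Measure (Torus d)).real {x | ‖x‖ ≤ r}

/-- A continuous power law on `[1, ∞)` with exponent `τ`: there is a density that vanishes
below `1` and is `Θ(x ^ (-τ))` as `x → ∞`. -/
def IsContinuousPowerLaw (τ : ℝ) (D : Measure ℝ) : Prop :=
  ∃ f : ℝ → ℝ, Measurable f ∧ (∀ x, 0 ≤ f x) ∧ (∀ x < 1, f x = 0) ∧
    D = volume.withDensity (fun x => ENNReal.ofReal (f x)) ∧
    ∃ c₁ c₂ x₀ : ℝ, 0 < c₁ ∧ 0 < c₂ ∧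
      ∀ x : ℝ, 1 ≤ x → x₀ ≤ x → c₁ * x ^ (-τ) ≤ f x ∧ f x ≤ c₂ * x ^ (-τ)

/-- A discrete power law with exponent `τ`: a law on the positive integers for which the
probability of `k` is `Θ(k ^ (-τ))` as `k → ∞`. -/
def IsDiscretePowerLaw (τ : ℝ) (D : Measure ℝ) : Prop :=
  D {x : ℝ | ∃ k : ℕ, 1 ≤ k ∧ x = k}ᶜ = 0 ∧
    ∃ c₁ c₂ x₀ : ℝ, 0 < c₁ ∧ 0 < c₂ ∧
      ∀ k : ℕ, 1 ≤ k → x₀ ≤ (k : ℝ) →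
        c₁ * (k : ℝ) ^ (-τ) ≤ D.real {(k : ℝ)} ∧ D.real {(k : ℝ)} ≤ c₂ * (k : ℝ) ^ (-τ)

/-- A power law on `[1, ∞)` with exponent `τ`, either continuous or discrete. -/
def IsPowerLaw (τ : ℝ) (D : Measure ℝ) : Prop :=
  IsContinuousPowerLaw τ D ∨ IsDiscretePowerLaw τ D

/-- The minimum of `(w * w' / (n * V(‖x - y‖))) ^ α` and `1`, for `x ≠ y`, where `V` is the
volume of a ball of the given radius. -/
noncomputable def connectionScale (d : ℕ) (α : ℝ) (n : ℕ) (x y : Torus d) (w w' : ℝ) : ℝ :=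
  min ((w * w' / ((n : ℝ) * ballVolume d ‖x - y‖)) ^ α) 1

/-- An admissible family of connection probabilities: for each intensity `n ≥ 1`, a symmetric
measurable function of two positions and two weights which lies between `θ₁` and `θ₂` times
`connectionScale`. (Coinciding positions occur with probability zero.) -/
structure ConnectionProbability (d : ℕ) (α θ₁ θ₂ : ℝ) where
  /-- the connection probability at intensity `n`, as a function of positions and weights -/
  prob : ℕ → Torus d → Torus d → ℝ → ℝ → ℝ
  measurable_prob : ∀ n, Measurable
    (fun z : (Torus d × Torus d) × (ℝ × ℝ) => prob n z.1.1 z.1.2 z.2.1 z.2.2)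
  symm : ∀ n x y w w', prob n x y w w' = prob n y x w' w
  lower : ∀ n x y w w', 1 ≤ n → x ≠ y → 1 ≤ w → 1 ≤ w' →
    θ₁ * connectionScale d α n x y w w' ≤ prob n x y w w'
  upper : ∀ n x y w w', 1 ≤ n → x ≠ y → 1 ≤ w → 1 ≤ w' →
    prob n x y w w' ≤ θ₂ * connectionScale d α n x y w w'

/-- The randomness that generates the graph: the number of vertices, the sequence of positions, the
sequence of weights, and for each unordered pair of indices a number in `[0,1]` that
decides whether the pair is an edge. -/
abbrev GraphSample (d : ℕ) : Type :=
  ℕ × (ℕ → Torus d) × (ℕ → ℝ) × (Sym2 ℕ → unitInterval)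

/-- The randomness of the push-pull protocol: for each round `t`, each vertex `v` and each finite
set `A` of vertices, the element that `v` would choose in round `t` if its neighbourhood
were `A`. -/
abbrev ChoiceSample : Type := ℕ × ℕ × Finset ℕ → ℕ

/-- The uniform distribution on a finite set `A` (the value for `A = ∅` is an unused default). -/
noncomputable def uniformChoice (A : Finset ℕ) : Measure ℕ :=
  if h : A.Nonempty then (PMF.uniformOfFinset A h).toMeasure else Measure.dirac 0

instance (A : Finset ℕ) : IsProbabilityMeasure (uniformChoice A) := by
  unfold uniformChoice
  split <;> infer_instance

/-- The law of the randomness of the graph at intensity `n`: the number of vertices is Poisson with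
mean `n`, positions are i.i.d. uniform on the torus, weights are i.i.d. with law `D`, the numbers
deciding the edges are i.i.d. uniform on `[0,1]`, and all of these are independent. -/
noncomputable def graphLaw (d : ℕ) (D : Measure ℝ) [IsProbabilityMeasure D] (n : ℕ) :
    Measure (GraphSample d) :=
  (ProbabilityTheory.poissonMeasure (n : ℝ≥0)).prod
    ((Measure.infinitePi fun _ : ℕ => (volume : Measure (Torus d))).prod
      ((Measure.infinitePi fun _ : ℕ => D).prod
        (Measure.infinitePi fun _ : Sym2 ℕ => (volume : Measure unitInterval))))

/-- The law of the randomness of the protocol: all choices are independent and uniform. -/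
noncomputable def choiceLaw : Measure ChoiceSample :=
  Measure.infinitePi fun q : ℕ × ℕ × Finset ℕ => uniformChoice q.2.2

/-- The joint law of the graph and of the (independent) randomness of the protocol. -/
noncomputable def law (d : ℕ) (D : Measure ℝ) [IsProbabilityMeasure D] (n : ℕ) :
    Measure (GraphSample d × ChoiceSample) :=
  (graphLaw d D n).prod choiceLaw

instance (d : ℕ) (D : Measure ℝ) [IsProbabilityMeasure D] (n : ℕ) :
    IsProbabilityMeasure (law d D n) := by
  unfold law graphLaw choiceLaw
  infer_instance

variable {d : ℕ} {α θ₁ θ₂ : ℝ}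

/-- The number of vertices; the vertices are the natural numbers below it. -/
def numVertices (g : GraphSample d) : ℕ := g.1

/-- The position of a vertex. -/
def position (g : GraphSample d) (v : ℕ) : Torus d := g.2.1 v

/-- The weight of a vertex. -/
def weight (g : GraphSample d) (v : ℕ) : ℝ := g.2.2.1 v

/-- The graph of the GIRG at intensity `n`: given positions and weights, distinct vertices `u`
and `v` are joined independently with probability `p.prob n x_u x_v W_u W_v`. -/
def graph (p : ConnectionProbability d α θ₁ θ₂) (n : ℕ) (g : GraphSample d) :
    SimpleGraph ℕ where
  Adj u v := u ≠ v ∧ u < numVertices g ∧ v < numVertices g ∧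
    (g.2.2.2 s(u, v) : ℝ) < p.prob n (position g u) (position g v) (weight g u) (weight g v)
  symm := ⟨by
    rintro u v ⟨h, hu, hv, hp⟩
    exact ⟨h.symm, hv, hu, by rw [Sym2.eq_swap, p.symm]; exact hp⟩⟩
  loopless := ⟨fun _ h => h.1 rfl⟩

open Classical in
/-- The neighbourhood of `v` in a graph on the vertices `0, …, N - 1`. -/
noncomputable def neighbours (N : ℕ) (G : SimpleGraph ℕ) (v : ℕ) : Finset ℕ :=
  (Finset.range N).filter fun u => G.Adj v u

/-- The neighbour that `v` contacts in round `t`: uniformly random among its neighbours. -/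
noncomputable def contact (N : ℕ) (G : SimpleGraph ℕ) (c : ChoiceSample) (t v : ℕ) : ℕ :=
  c (t, v, neighbours N G v)

open Classical in
/-- The set of vertices informed after a given number of rounds of synchronous push-pull started
at `s`. In each round every vertex contacts a neighbour, and an uninformed `v` gets informed if an
informed neighbour `u` contacts `v` (push) or if `v` contacts an informed neighbour `u` (pull).
Isolated vertices take no part. -/
noncomputable def informed (N : ℕ) (G : SimpleGraph ℕ) (c : ChoiceSample) (s : ℕ) :
    ℕ → Finset ℕ
  | 0 => {s}
  | t + 1 => informed N G c s t ∪ (Finset.range N).filter fun v =>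
      ∃ u ∈ informed N G c s t, G.Adj u v ∧
        (contact N G c t u = v ∨ contact N G c t v = u)

/-- The set of vertices informed after `t` rounds of push-pull on the GIRG, started at `s`. -/
noncomputable def informedAfter (p : ConnectionProbability d α θ₁ θ₂) (n : ℕ)
    (ω : GraphSample d × ChoiceSample) (s t : ℕ) : Finset ℕ :=
  informed (numVertices ω.1) (graph p n ω.1) ω.2 s t

end GIRG

/-! The rumour is slow because, with high probability, no contact during the first `n ^ ρ₂` rounds
uses a long edge. Fix exponents `β ≤ α` and `γ < τ - 1`, a weight cap `M = n ^ μ` with `μ * γ > 1`,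
and a length `r = n ^ (-κ)` with small `κ > 0`. The `γ`-th moment of the weights is finite, so
Markov's inequality excludes all weights above `M`.

A vertex of weight `w` has expected degree at least of order `w`. A long edge from it may exist, but
it is chosen in a given round only with probability one over the degree, and the mean of this
reciprocal is of order at most `1 / w`. A pair of weights `w, w'` at distance more than `r` is
joined with probability at most `(w w' / (n V(r))) ^ β`. Up to constants, the expected number of
long contacts in one round is therefore at most `n ^ 2 (n V(r)) ^ (-β) E[w ^ (β - 1)] E[w' ^ β; w' ≤
M]`. Here `w ^ (β - 1) ≤ w ^ γ` and `w' ^ β ≤ M ^ (β - γ) w' ^ γ`, so both expectations are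
controlled by the same finite moment (`lintegral_longEdge_inv_degree_le`). As `κ → 0` and `μ → 1 /
γ`, the exponent of `n` tends to `1 - β + β / γ`. It is negative exactly when `γ > β / (β - 1)`.
Together with `β - 1 ≤ γ < τ - 1` this asks for `(τ - 1) / (τ - 2) < β < τ`, and such a `β` exists
because `τ > φ + 1` (`exists_exponents`).

Without long contacts, after `n ^ (κ / 2)` rounds the rumour is still within distance `n ^ (-κ / 2)`
of its start (`dist_le_of_mem_informed`). A Chernoff bound limits the number of vertices in every
such ball to order `n ^ (1 - κ d / 2)` (`sampleLaw_nearIn_ge_le`). Neither event depends on the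
starting vertex, so all starts are covered at once. -/

namespace GIRG

/-! ### Integration against i.i.d. families -/

section ProductMeasures

variable {ι X Y : Type*} [MeasurableSpace X] [MeasurableSpace Y]

/-- The integral of a product of functions of distinct coordinates is the product of the
integrals. -/
lemma lintegral_infinitePi_prod {κ : Type*} (μ : Measure X) [IsProbabilityMeasure μ]
    (e : κ → ι) (he : Function.Injective e) (S : Finset κ) (f : κ → X → ℝ≥0∞)
    (hf : ∀ i, Measurable (f i)) :
    ∫⁻ x : ι → X, ∏ i ∈ S, f i (x (e i)) ∂(Measure.infinitePi fun _ : ι => μ)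
      = ∏ i ∈ S, ∫⁻ x, f i x ∂μ := by
  have hmap := Measure.map_infinitePi_infinitePi_of_inj (P := fun _ : ι => μ) he
  have hindep := ProbabilityTheory.iIndepFun_infinitePi (P := fun _ : κ => μ) (X := f) hf
  calc ∫⁻ x : ι → X, ∏ i ∈ S, f i (x (e i)) ∂(Measure.infinitePi fun _ : ι => μ)
      = ∫⁻ x : κ → X, ∏ i ∈ S, f i (x i) ∂(Measure.infinitePi fun _ : κ => μ) := by
        rw [← hmap, lintegral_map (by fun_prop) (by fun_prop)]
    _ = ∏ i ∈ S, ∫⁻ x : κ → X, f i (x i) ∂(Measure.infinitePi fun _ : κ => μ) :=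
        ProbabilityTheory.lintegral_prod_eq_prod_lintegral_of_indepFun S
          (fun i (x : κ → X) => f i (x i)) hindep (fun i => (hf i).comp (measurable_pi_apply i))
    _ = _ := by
        refine Finset.prod_congr rfl fun i _ => ?_
        exact (measurePreserving_eval_infinitePi (fun _ : κ => μ) i).lintegral_comp (hf i)

/-- A pair of independent i.i.d. families is an i.i.d. family of pairs. -/
lemma measurePreserving_zip (μ : Measure X) (ν : Measure Y) [IsProbabilityMeasure μ]
    [IsProbabilityMeasure ν] :
    MeasurePreserving (fun (z : (ι → X) × (ι → Y)) i => (z.1 i, z.2 i))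
      ((Measure.infinitePi fun _ : ι => μ).prod (Measure.infinitePi fun _ : ι => ν))
      (Measure.infinitePi fun _ : ι => μ.prod ν) := by
  refine ⟨by fun_prop, Measure.eq_infinitePi _ fun S t ht => ?_⟩
  rw [Measure.map_apply (by fun_prop) (.pi S.countable_toSet fun i _ => ht i),
    Measure.prod_apply ((MeasurableSet.pi S.countable_toSet fun i _ => ht i).preimage
      (by fun_prop))]
  have h : ∀ x : ι → X, (Measure.infinitePi fun _ : ι => ν)
      (Prod.mk x ⁻¹' ((fun (z : (ι → X) × (ι → Y)) i => (z.1 i, z.2 i)) ⁻¹' (S : Set ι).pi t))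
      = ∏ i ∈ S, ν (Prod.mk (x i) ⁻¹' t i) := by
    intro x
    rw [← Measure.infinitePi_pi (fun _ : ι => ν) (s := S)
      (t := fun i => Prod.mk (x i) ⁻¹' t i) (fun i _ => (ht i).preimage (by fun_prop))]
    rfl
  simp_rw [h]
  refine (lintegral_infinitePi_prod μ id Function.injective_id S
    (fun i x => ν (Prod.mk x ⁻¹' t i)) (fun i => measurable_measure_prodMk_left (ht i))).trans ?_
  exact Finset.prod_congr rfl fun i _ => (Measure.prod_apply (ht i)).symm

/-- Resampling one coordinate of an i.i.d. family preserves its law. -/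
lemma measurePreserving_update [DecidableEq ι] (μ : Measure X) [IsProbabilityMeasure μ] (u : ι) :
    MeasurePreserving (fun (z : X × (ι → X)) => Function.update z.2 u z.1)
      (μ.prod (Measure.infinitePi fun _ : ι => μ)) (Measure.infinitePi fun _ : ι => μ) := by
  have hm : Measurable (fun (z : X × (ι → X)) => Function.update z.2 u z.1) := by
    refine measurable_pi_lambda _ fun i => ?_
    by_cases h : i = u
    · subst h; simpa using measurable_fst
    · simp only [Function.update_of_ne h]; fun_prop
  refine ⟨hm, Measure.eq_infinitePi _ fun S t ht => ?_⟩
  rw [Measure.map_apply hm (.pi S.countable_toSet fun i _ => ht i)]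
  by_cases hu : u ∈ S
  · have : (fun (z : X × (ι → X)) => Function.update z.2 u z.1) ⁻¹' (S : Set ι).pi t
        = t u ×ˢ ((S.erase u : Finset ι) : Set ι).pi t := by
      ext z
      simp only [Set.mem_preimage, Set.mem_pi, Finset.mem_coe, Set.mem_prod, Finset.mem_erase]
      constructor
      · intro h
        refine ⟨by simpa using h u hu, fun i hi => by simpa [hi.1] using h i hi.2⟩
      · rintro ⟨h1, h2⟩ i hi
        by_cases h : i = u
        · subst h; simpa using h1
        · simpa [h] using h2 i ⟨h, hi⟩
    rw [this, Measure.prod_prod, Measure.infinitePi_pi _ (fun i _ => ht i),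
      Finset.mul_prod_erase S (fun i => μ (t i)) hu]
  · have : (fun (z : X × (ι → X)) => Function.update z.2 u z.1) ⁻¹' (S : Set ι).pi t
        = Set.univ ×ˢ (S : Set ι).pi t := by
      ext z
      simp only [Set.mem_preimage, Set.mem_pi, Finset.mem_coe, Set.mem_prod, Set.mem_univ,
        true_and]
      refine forall₂_congr fun i hi => ?_
      rw [Function.update_of_ne (by rintro rfl; exact hu hi)]
    rw [this, Measure.prod_prod, Measure.infinitePi_pi _ (fun i _ => ht i)]
    simp

/-- Conditioning an i.i.d. family on the value of the coordinate `u`. -/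
lemma lintegral_infinitePi_split (μ : Measure X) [IsProbabilityMeasure μ] (u : ι) (S : Finset ι)
    (hu : u ∉ S) (g : X → ℝ≥0∞) (hg : Measurable g) (f : ι → X → X → ℝ≥0∞)
    (hf : ∀ i, Measurable fun z : X × X => f i z.1 z.2) :
    ∫⁻ x, g (x u) * ∏ i ∈ S, f i (x u) (x i) ∂(Measure.infinitePi fun _ : ι => μ)
      = ∫⁻ y, g y * ∏ i ∈ S, ∫⁻ x, f i y x ∂μ ∂μ := by
  classical
  have hm : ∀ i, Measurable fun x : ι → X => f i (x u) (x i) := fun i =>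
    (hf i).comp (g := fun z : X × X => f i z.1 z.2) (f := fun x : ι → X => (x u, x i))
      (by fun_prop)
  have hm' : ∀ i, Measurable fun z : X × (ι → X) => f i z.1 (z.2 i) := fun i =>
    (hf i).comp (g := fun z : X × X => f i z.1 z.2)
      (f := fun z : X × (ι → X) => (z.1, z.2 i)) (by fun_prop)
  -- After resampling, the value at `u` is a separate variable independent of all other coordinates,
  -- so it can be frozen while these are integrated.
  rw [← (measurePreserving_update μ u).lintegral_comp (by fun_prop)]
  have : ∀ z : X × (ι → X),
      (g (Function.update z.2 u z.1 u) * ∏ i ∈ S, f i (Function.update z.2 u z.1 u)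
        (Function.update z.2 u z.1 i)) = g z.1 * ∏ i ∈ S, f i z.1 (z.2 i) := by
    intro z
    simp only [Function.update_self]
    congr 1
    refine Finset.prod_congr rfl fun i hi => ?_
    rw [Function.update_of_ne (by rintro rfl; exact hu hi)]
  simp_rw [this]
  rw [lintegral_prod _ (by fun_prop)]
  refine lintegral_congr fun y => ?_
  have hy : ∀ i, Measurable (f i y) := fun i => (hf i).comp measurable_prodMk_left
  dsimp only
  rw [lintegral_const_mul _ (by fun_prop)]
  exact congrArg _ (lintegral_infinitePi_prod μ id Function.injective_id S (fun i => f i y) hy)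

end ProductMeasures

/-! ### A Poisson sum and volumes of torus balls -/

/-- This is the derivative of the Poisson generating function at `s`. The factor `m` comes from a
union over vertices and `s ^ (m - 1)` from the independent contributions of the others; `s = 1`
gives the mean. -/
lemma lintegral_poisson_mul_pow (n : ℕ) (s : ℝ) (hs : 0 ≤ s) :
    ∑' m : ℕ, ProbabilityTheory.poissonMeasure (n : ℝ≥0) {m} *
      ((m : ℝ≥0∞) * ENNReal.ofReal s ^ (m - 1))
      = ENNReal.ofReal (n * Real.exp (n * (s - 1))) := by
  have key : HasSum (fun m : ℕ => Real.exp (-(n : ℝ)) * (n : ℝ) ^ m / (m.factorial : ℝ) *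
      (m * s ^ (m - 1))) (n * Real.exp (n * (s - 1))) := by
    -- The term `m = 0` vanishes; shifting the index removes the truncated `m - 1` and cancels `m`
    -- against the factorial.
    rw [← hasSum_nat_add_iff' 1]
    have h := (NormedSpace.expSeries_div_hasSum_exp ((n : ℝ) * s)).mul_left
      (n * Real.exp (-(n : ℝ)))
    rw [← Real.exp_eq_exp_ℝ] at h
    have e1 : (fun m : ℕ => Real.exp (-(n : ℝ)) * (n : ℝ) ^ (m + 1) / ((m + 1).factorial : ℝ) *
        (((m + 1 : ℕ) : ℝ) * s ^ (m + 1 - 1)))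
        = fun m : ℕ => n * Real.exp (-(n : ℝ)) * (((n : ℝ) * s) ^ m / m.factorial) := by
      ext m
      rw [Nat.factorial_succ]
      have : (m.factorial : ℝ) ≠ 0 := by positivity
      push_cast
      field_simp
      ring
    rw [e1]
    have e2 : n * Real.exp (n * (s - 1)) - ∑ i ∈ Finset.range 1,
        Real.exp (-(n : ℝ)) * (n : ℝ) ^ i / (i.factorial : ℝ) * (i * s ^ (i - 1))
        = n * Real.exp (-(n : ℝ)) * Real.exp (n * s) := by
      rw [mul_assoc, ← Real.exp_add]
      simp
      ring_nf
      simp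
    rw [e2]
    exact h
  rw [← key.tsum_eq, ENNReal.ofReal_tsum_of_nonneg (fun m => by positivity) key.summable]
  refine tsum_congr fun m => ?_
  rw [ProbabilityTheory.poissonMeasure_singleton, ENNReal.ofReal_mul (by positivity),
    ENNReal.ofReal_mul (by positivity), ENNReal.ofReal_pow hs, ENNReal.ofReal_natCast]
  simp

lemma closedBall_zero_eq (d : ℕ) (r : ℝ) :
    {x : Torus d | ‖x‖ ≤ r} = Metric.closedBall 0 r := by
  ext x; simp

lemma volume_closedBall_torus (d : ℕ) (x : Torus d) {r : ℝ} (hr : 0 ≤ r) :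
    volume (Metric.closedBall x r) = ENNReal.ofReal (min 1 (2 * r) ^ d) := by
  rw [closedBall_pi _ hr, volume_pi_pi]
  simp only [AddCircle.volume_closedBall, Finset.prod_const, Finset.card_univ, Fintype.card_fin]
  rw [ENNReal.ofReal_pow (by positivity)]

lemma ballVolume_eq (d : ℕ) {r : ℝ} (hr : 0 ≤ r) : ballVolume d r = min 1 (2 * r) ^ d := by
  rw [ballVolume, closedBall_zero_eq, Measure.real, volume_closedBall_torus d 0 hr,
    ENNReal.toReal_ofReal (by positivity)]

/-! ### Conditioning on the position and weight of one vertex -/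

/-- Conditioning on the entries with index `u` of two i.i.d. families, in the presence of a third
family indexed by unordered pairs. -/
lemma lintegral_triple_split {A B U : Type*} [MeasurableSpace A] [MeasurableSpace B]
    [MeasurableSpace U] (μ : Measure A) (ν : Measure B) (ξ : Measure U) [IsProbabilityMeasure μ]
    [IsProbabilityMeasure ν] [IsProbabilityMeasure ξ] (u : ℕ) (S : Finset ℕ)
    (hu : u ∉ S) (g : A × B → ℝ≥0∞) (hg : Measurable g) (f : ℕ → A × B → A × B → U → ℝ≥0∞)
    (hf : ∀ i, Measurable fun z : ((A × B) × (A × B)) × U => f i z.1.1 z.1.2 z.2) :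
    ∫⁻ z : (ℕ → A) × (ℕ → B) × (Sym2 ℕ → U), g (z.1 u, z.2.1 u) *
        ∏ i ∈ S, f i (z.1 u, z.2.1 u) (z.1 i, z.2.1 i) (z.2.2 s(u, i))
        ∂((Measure.infinitePi fun _ : ℕ => μ).prod ((Measure.infinitePi fun _ : ℕ => ν).prod
          (Measure.infinitePi fun _ : Sym2 ℕ => ξ)))
      = ∫⁻ y, g y * ∏ i ∈ S, ∫⁻ x, (∫⁻ t, f i y x t ∂ξ) ∂(μ.prod ν) ∂(μ.prod ν) := by
  have hf1 : ∀ i, Measurable fun z : (ℕ → A) × (ℕ → B) × (Sym2 ℕ → U) =>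
      f i (z.1 u, z.2.1 u) (z.1 i, z.2.1 i) (z.2.2 s(u, i)) := fun i =>
    (hf i).comp (g := fun z : ((A × B) × (A × B)) × U => f i z.1.1 z.1.2 z.2)
      (f := fun z : (ℕ → A) × (ℕ → B) × (Sym2 ℕ → U) =>
        (((z.1 u, z.2.1 u), (z.1 i, z.2.1 i)), z.2.2 s(u, i))) (by fun_prop)
  have hf2 : ∀ i, Measurable fun z : (A × B) × (A × B) => ∫⁻ t, f i z.1 z.2 t ∂ξ :=
    fun i => (hf i).lintegral_prod_right'
  have hf3 : ∀ i, ∀ y x, Measurable (f i y x) := fun i y x =>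
    (hf i).comp (measurable_prodMk_left (x := (y, x)))
  -- With one endpoint fixed, different `i` give different unordered pairs, so the edge variables at
  -- `u` are independent.
  have he : Function.Injective fun i : ℕ => s(u, i) := fun i j h => by
    rcases Sym2.eq_iff.mp h with h | h
    · exact h.2
    · exact h.2.trans h.1
  have hf4 : ∀ i, Measurable fun z : (ℕ → A) × (ℕ → B) =>
      ∫⁻ t, f i (z.1 u, z.2 u) (z.1 i, z.2 i) t ∂ξ := fun i =>
    (hf2 i).comp (g := fun z : (A × B) × (A × B) => ∫⁻ t, f i z.1 z.2 t ∂ξ)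
      (f := fun z : (ℕ → A) × (ℕ → B) => ((z.1 u, z.2 u), (z.1 i, z.2 i))) (by fun_prop)
  have hF : Measurable fun z : (ℕ → A) × (ℕ → B) × (Sym2 ℕ → U) => g (z.1 u, z.2.1 u) *
        ∏ i ∈ S, f i (z.1 u, z.2.1 u) (z.1 i, z.2.1 i) (z.2.2 s(u, i)) :=
    Measurable.mul (by fun_prop) (Finset.measurable_fun_prod S fun i _ => hf1 i)
  rw [lintegral_prod _ hF.aemeasurable]
  have step : ∀ x : ℕ → A, ∫⁻ y : (ℕ → B) × (Sym2 ℕ → U), g (x u, y.1 u) *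
        ∏ i ∈ S, f i (x u, y.1 u) (x i, y.1 i) (y.2 s(u, i))
        ∂((Measure.infinitePi fun _ : ℕ => ν).prod (Measure.infinitePi fun _ : Sym2 ℕ => ξ))
      = ∫⁻ w : ℕ → B, g (x u, w u) * ∏ i ∈ S, ∫⁻ t, f i (x u, w u) (x i, w i) t ∂ξ
        ∂(Measure.infinitePi fun _ : ℕ => ν) := by
    intro x
    refine (lintegral_prod _ (hF.comp (measurable_prodMk_left (x := x))).aemeasurable).trans ?_
    refine lintegral_congr fun w => ?_
    have hm : Measurable fun y : Sym2 ℕ → U =>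
        ∏ i ∈ S, f i (x u, w u) (x i, w i) (y s(u, i)) :=
      Finset.measurable_fun_prod S fun i _ => (hf3 i _ _).comp (measurable_pi_apply _)
    refine (lintegral_const_mul (g (x u, w u)) hm).trans ?_
    congr 1
    exact lintegral_infinitePi_prod ξ (fun i : ℕ => s(u, i)) he S
      (fun i => f i (x u, w u) (x i, w i)) (fun i => hf3 i _ _)
  simp only [step]
  rw [← lintegral_infinitePi_split (μ.prod ν) u S hu g hg (fun i y x => ∫⁻ t, f i y x t ∂ξ) hf2]
  rw [← (measurePreserving_zip (ι := ℕ) μ ν).lintegral_comp]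
  · rw [lintegral_prod]
    exact (Measurable.mul (by fun_prop)
      (Finset.measurable_fun_prod S fun i _ => hf4 i)).aemeasurable
  · refine Measurable.mul (by fun_prop) (Finset.measurable_fun_prod S fun i _ => ?_)
    exact (hf2 i).comp (g := fun z : (A × B) × (A × B) => ∫⁻ t, f i z.1 z.2 t ∂ξ)
      (f := fun x : ℕ → A × B => (x u, x i)) (by fun_prop)

section Sample

variable {d : ℕ}

/-- The positions, the weights and the numbers deciding the edges. -/
abbrev MarkSample (d : ℕ) : Type := (ℕ → Torus d) × (ℕ → ℝ) × (Sym2 ℕ → unitInterval)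

/-- The law of the positions, the weights and the numbers deciding the edges. -/
noncomputable def sampleLaw (d : ℕ) (D : Measure ℝ) [IsProbabilityMeasure D] :
    Measure (MarkSample d) :=
  (Measure.infinitePi fun _ : ℕ => (volume : Measure (Torus d))).prod
    ((Measure.infinitePi fun _ : ℕ => D).prod
      (Measure.infinitePi fun _ : Sym2 ℕ => (volume : Measure unitInterval)))

instance (D : Measure ℝ) [IsProbabilityMeasure D] : IsProbabilityMeasure (sampleLaw d D) := by
  unfold sampleLaw
  infer_instance

/-- Position and weight of a vertex. -/
def mark (z : MarkSample d) (v : ℕ) : Torus d × ℝ := (z.1 v, z.2.1 v)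

@[fun_prop]
lemma measurable_mark (v : ℕ) : Measurable fun z : MarkSample d => mark z v := by
  unfold mark
  fun_prop

/-- Conditioning on position and weight of the vertex `u`. -/
lemma lintegral_sampleLaw_split (D : Measure ℝ) [IsProbabilityMeasure D] (u : ℕ) (S : Finset ℕ)
    (hu : u ∉ S) (g : Torus d × ℝ → ℝ≥0∞) (hg : Measurable g)
    (f : ℕ → Torus d × ℝ → Torus d × ℝ → unitInterval → ℝ≥0∞)
    (hf : ∀ i, Measurable fun z : ((Torus d × ℝ) × (Torus d × ℝ)) × unitInterval =>
      f i z.1.1 z.1.2 z.2) :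
    ∫⁻ z, g (mark z u) * ∏ i ∈ S, f i (mark z u) (mark z i) (z.2.2 s(u, i)) ∂(sampleLaw d D)
      = ∫⁻ y, g y * ∏ i ∈ S, ∫⁻ x, (∫⁻ t, f i y x t) ∂(volume.prod D) ∂(volume.prod D) :=
  lintegral_triple_split volume D volume u S hu g hg f hf

end Sample

/-! ### Moments of power laws -/

lemma IsPowerLaw.ae_one_le {τ : ℝ} {D : Measure ℝ} (h : IsPowerLaw τ D) : ∀ᵐ x ∂D, 1 ≤ x := by
  rcases h with ⟨f, hf, -, hf1, rfl, -⟩ | ⟨h0, -⟩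
  · rw [ae_withDensity_iff (by fun_prop)]
    refine ae_of_all _ fun x hx => ?_
    by_contra hlt
    exact hx (by rw [hf1 x (not_le.mp hlt), ENNReal.ofReal_zero])
  · filter_upwards [mem_ae_iff.mpr h0] with x hx
    obtain ⟨k, hk, rfl⟩ := hx
    exact_mod_cast hk

/-- Up to a threshold the integrand is at most a constant times the density, which has mass one;
beyond it `x ^ (γ - τ)` is integrable since `γ - τ < -1`. -/
lemma IsContinuousPowerLaw.lintegral_rpow_lt_top {τ γ : ℝ} {D : Measure ℝ}
    [IsProbabilityMeasure D] (h : IsContinuousPowerLaw τ D) (hγ : 0 ≤ γ) (hγτ : γ < τ - 1) :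
    ∫⁻ x, ENNReal.ofReal (x ^ γ) ∂D < ∞ := by
  obtain ⟨f, hf, hf0, hf1, hD, c₁, c₂, x₀, -, hc₂, hb⟩ := h
  set X := max 1 x₀
  have hX : 1 ≤ X := le_max_left _ _
  have hfin : ∫⁻ x, ENNReal.ofReal (f x) = 1 := by
    have h1 : D Set.univ = 1 := measure_univ
    rwa [hD, withDensity_apply _ .univ, setLIntegral_univ] at h1
  rw [hD, lintegral_withDensity_eq_lintegral_mul _ (by fun_prop) (by fun_prop)]
  have hle : ∀ x, ((fun x => ENNReal.ofReal (f x)) * fun x => ENNReal.ofReal (x ^ γ)) x ≤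
      ENNReal.ofReal (X ^ γ) * ENNReal.ofReal (f x) +
        (Set.Ioi X).indicator (fun x => ENNReal.ofReal (c₂ * x ^ (γ - τ))) x := by
    intro x
    simp only [Pi.mul_apply]
    rcases lt_or_ge x 1 with hx | hx
    · simp [hf1 x hx]
    · have hx0 : 0 < x := by linarith
      rcases le_or_gt x X with hxX | hxX
      · refine le_add_right ?_
        rw [mul_comm]
        gcongr
      · refine le_add_left ?_
        rw [Set.indicator_of_mem (by exact hxX), ← ENNReal.ofReal_mul (hf0 x)]
        refine ENNReal.ofReal_le_ofReal ?_
        have := (hb x hx ((le_max_right _ _).trans hxX.le)).2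
        calc f x * x ^ γ ≤ c₂ * x ^ (-τ) * x ^ γ := by gcongr
          _ = c₂ * x ^ (γ - τ) := by
            rw [mul_assoc, ← Real.rpow_add hx0]; ring_nf
  refine (lintegral_mono hle).trans_lt ?_
  rw [lintegral_add_left (by fun_prop), lintegral_const_mul _ (by fun_prop), hfin,
    lintegral_indicator measurableSet_Ioi]
  refine ENNReal.add_lt_top.mpr ⟨by simp, ?_⟩
  have hint : IntegrableOn (fun x : ℝ => c₂ * x ^ (γ - τ)) (Set.Ioi X) :=
    (integrableOn_Ioi_rpow_of_lt (by linarith) (by linarith)).const_mul c₂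
  exact hint.lintegral_lt_top

lemma IsDiscretePowerLaw.lintegral_rpow_lt_top {τ γ : ℝ} {D : Measure ℝ}
    [IsProbabilityMeasure D] (h : IsDiscretePowerLaw τ D) (hγτ : γ < τ - 1) :
    ∫⁻ x, ENNReal.ofReal (x ^ γ) ∂D < ∞ := by
  obtain ⟨h0, c₁, c₂, x₀, -, hc₂, hb⟩ := h
  have hD : D.restrict (Set.range ((↑) : ℕ → ℝ)) = D := by
    refine Measure.restrict_eq_self_of_ae_mem ?_
    filter_upwards [mem_ae_iff.mpr h0] with x hx
    obtain ⟨k, -, rfl⟩ := hx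
    exact ⟨k, rfl⟩
  rw [← hD, lintegral_countable _ (Set.countable_range _),
    tsum_range (fun x : ℝ => ENNReal.ofReal (x ^ γ) * D {x}) Nat.cast_injective]
  have hsum : Summable fun k : ℕ => (k : ℝ) ^ γ * D.real {(k : ℝ)} := by
    refine Summable.of_norm_bounded_eventually_nat (g := fun k : ℕ => c₂ * (k : ℝ) ^ (γ - τ))
      ((Real.summable_nat_rpow.mpr (by linarith)).mul_left c₂) ?_
    filter_upwards [eventually_ge_atTop 1, eventually_ge_atTop ⌈x₀⌉₊] with k hk hk0
    have hk' : (0 : ℝ) < k := by exact_mod_cast hk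
    rw [Real.norm_of_nonneg (by positivity)]
    calc (k : ℝ) ^ γ * D.real {(k : ℝ)} ≤ (k : ℝ) ^ γ * (c₂ * (k : ℝ) ^ (-τ)) := by
          gcongr
          exact (hb k hk (Nat.ceil_le.mp hk0)).2
      _ = c₂ * (k : ℝ) ^ (γ - τ) := by
          rw [mul_left_comm, ← Real.rpow_add hk']; ring_nf
  refine lt_of_eq_of_lt (tsum_congr fun k => ?_) hsum.tsum_ofReal_lt_top
  rw [ENNReal.ofReal_mul (by positivity), ofReal_measureReal]

lemma IsPowerLaw.lintegral_rpow_lt_top {τ γ : ℝ} {D : Measure ℝ} [IsProbabilityMeasure D]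
    (h : IsPowerLaw τ D) (hγ : 0 ≤ γ) (hγτ : γ < τ - 1) :
    ∫⁻ x, ENNReal.ofReal (x ^ γ) ∂D < ∞ :=
  h.elim (fun h => h.lintegral_rpow_lt_top hγ hγτ) (fun h => h.lintegral_rpow_lt_top hγτ)

/-! ### Integrals over the unit interval -/

lemma lintegral_unitInterval (f : ℝ → ℝ) (hf : Continuous f)
    (h0 : ∀ s ∈ Set.Icc (0 : ℝ) 1, 0 ≤ f s) :
    ∫⁻ s : unitInterval, ENNReal.ofReal (f s) = ENNReal.ofReal (∫ s in (0 : ℝ)..1, f s) := by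
  have h1 : ∫⁻ s : unitInterval, ENNReal.ofReal (f s)
      = ∫⁻ s in Set.Icc (0 : ℝ) 1, ENNReal.ofReal (f s) :=
    lintegral_subtype_comap measurableSet_Icc (fun s => ENNReal.ofReal (f s))
  rw [h1, intervalIntegral.integral_of_le zero_le_one, ← integral_Icc_eq_integral_Ioc,
    ofReal_integral_eq_lintegral_ofReal (hf.integrableOn_Icc)
      ((ae_restrict_iff' measurableSet_Icc).mpr (ae_of_all _ h0))]

/-- Used with `k` a degree: it turns a reciprocal degree into an average of powers, which factorise
over independent edges. -/
lemma lintegral_unitInterval_pow (k : ℕ) :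
    ∫⁻ s : unitInterval, ENNReal.ofReal s ^ k = ((k : ℝ≥0∞) + 1)⁻¹ := by
  have h := lintegral_unitInterval (fun s => s ^ k) (by fun_prop)
    (fun s hs => pow_nonneg hs.1 k)
  simp only [integral_pow] at h
  rw [← ENNReal.ofReal_natCast, ← ENNReal.ofReal_one, ← ENNReal.ofReal_add (by positivity)
    zero_le_one, ← ENNReal.ofReal_inv_of_pos (by positivity)]
  convert h using 2
  · ext s
    rw [ENNReal.ofReal_pow s.2.1]
  · simp

/-- The integrand is the generating function of a binomial variable `X` with `k` trials and success
probability `q`, so this bounds the mean of `1 / (X + 1)`. -/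
lemma lintegral_unitInterval_affine_pow (q q' : ℝ≥0∞) (h : q + q' = 1) (k : ℕ) :
    ∫⁻ s : unitInterval, (q * ENNReal.ofReal s + q') ^ k ≤ (((k : ℝ≥0∞) + 1) * q)⁻¹ := by
  have hq : q ≠ ∞ := by rintro rfl; simp at h
  have hq' : q' ≠ ∞ := by rintro rfl; simp at h
  lift q to ℝ≥0 using hq
  lift q' to ℝ≥0 using hq'
  have h' : q' = (1 : ℝ) - q := by
    have : (q : ℝ) + q' = 1 := by exact_mod_cast h
    linarith
  -- For `q = 0` the right-hand side is `∞`.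
  rcases eq_or_ne q 0 with rfl | hq0
  · simp
  have hq0' : (0 : ℝ) < q := by positivity
  have e := lintegral_unitInterval (fun s => (q * s + q') ^ k) (by fun_prop)
    (fun s hs => by have := hs.1; positivity)
  have e1 : ∀ s : unitInterval, ((q : ℝ≥0∞) * ENNReal.ofReal s + q') ^ k
      = ENNReal.ofReal ((q * (s : ℝ) + q') ^ k) := by
    intro s
    have hs := s.2.1
    rw [ENNReal.ofReal_pow (by positivity), ENNReal.ofReal_add (by positivity) (by positivity),
      ENNReal.ofReal_mul (by positivity)]
    simp
  simp_rw [e1]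
  rw [e]
  have hint : ∫ s in (0 : ℝ)..1, ((q : ℝ) * s + q') ^ k
      = (1 - (q' : ℝ) ^ (k + 1)) / ((k + 1) * q) := by
    have hd : ∀ s ∈ Set.uIcc (0 : ℝ) 1, HasDerivAt
        (fun s : ℝ => ((q : ℝ) * s + q') ^ (k + 1) / ((k + 1) * q)) (((q : ℝ) * s + q') ^ k) s := by
      intro s _
      have h1 : HasDerivAt (fun s : ℝ => (q : ℝ) * s + q') q s := by
        simpa using ((hasDerivAt_id s).const_mul (q : ℝ)).add_const (q' : ℝ)
      have h2 := (h1.pow (k + 1)).div_const ((k + 1) * (q : ℝ))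
      refine h2.congr_deriv ?_
      push_cast
      field_simp
    rw [intervalIntegral.integral_eq_sub_of_hasDerivAt hd
      ((by fun_prop : Continuous fun s : ℝ => ((q : ℝ) * s + q') ^ k).intervalIntegrable _ _)]
    rw [h']
    ring
  rw [hint]
  calc ENNReal.ofReal ((1 - (q' : ℝ) ^ (k + 1)) / ((k + 1) * q))
      ≤ ENNReal.ofReal (((k + 1) * q : ℝ)⁻¹) := by
        refine ENNReal.ofReal_le_ofReal ?_
        rw [inv_eq_one_div]
        gcongr
        have : (0 : ℝ) ≤ (q' : ℝ) ^ (k + 1) := by positivity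
        linarith
    _ = _ := by
        rw [ENNReal.ofReal_inv_of_pos (by positivity), ENNReal.ofReal_mul (by positivity),
          ENNReal.ofReal_add (by positivity) (by positivity)]
        simp

lemma volume_unitInterval_lt_le (c : ℝ) :
    (volume : Measure unitInterval) {t | (t : ℝ) < c} ≤ ENNReal.ofReal c := by
  have h : (volume : Measure unitInterval) {t | (t : ℝ) < c}
      = volume.restrict (Set.Icc (0 : ℝ) 1) (Set.Iio c) := by
    rw [← (unitInterval.measurePreserving_coe).measure_preimage measurableSet_Iio.nullMeasurableSet]
    rfl
  rw [h, Measure.restrict_apply measurableSet_Iio]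
  refine (measure_mono (t := Set.Ico 0 c) ?_).trans_eq (by simp)
  rintro x ⟨h1, h2, -⟩
  exact ⟨h2, h1⟩

lemma le_volume_unitInterval_lt {c : ℝ} (hc : c ≤ 1) :
    ENNReal.ofReal c ≤ (volume : Measure unitInterval) {t | (t : ℝ) < c} := by
  have h : (volume : Measure unitInterval) {t | (t : ℝ) < c}
      = volume.restrict (Set.Icc (0 : ℝ) 1) (Set.Iio c) := by
    rw [← (unitInterval.measurePreserving_coe).measure_preimage measurableSet_Iio.nullMeasurableSet]
    rfl
  rw [h, Measure.restrict_apply measurableSet_Iio]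
  refine Eq.trans_le (b := volume (Set.Ico 0 c)) (by simp) (measure_mono ?_)
  rintro x ⟨h1, h2⟩
  exact ⟨h2, h1, by linarith⟩

/-! ### The expected reciprocal of a degree -/

variable {d : ℕ} {α θ₁ θ₂ : ℝ}

/-- The connection probability of two vertices with given positions and weights. -/
def connect (p : ConnectionProbability d α θ₁ θ₂) (n : ℕ) (y x : Torus d × ℝ) : ℝ :=
  p.prob n y.1 x.1 y.2 x.2

lemma measurable_connect (p : ConnectionProbability d α θ₁ θ₂) (n : ℕ) :
    Measurable fun z : (Torus d × ℝ) × (Torus d × ℝ) => connect p n z.1 z.2 :=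
  (p.measurable_prob n).comp
    (g := fun z : (Torus d × Torus d) × (ℝ × ℝ) => p.prob n z.1.1 z.1.2 z.2.1 z.2.2)
    (f := fun z : (Torus d × ℝ) × (Torus d × ℝ) => ((z.1.1, z.2.1), (z.1.2, z.2.2)))
    (by fun_prop)

lemma measurableSet_connect (p : ConnectionProbability d α θ₁ θ₂) (n : ℕ) :
    MeasurableSet {z : ((Torus d × ℝ) × (Torus d × ℝ)) × unitInterval |
      (z.2 : ℝ) < connect p n z.1.1 z.1.2} :=
  measurableSet_lt (by fun_prop) ((measurable_connect p n).comp measurable_fst)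

/-- The probability that a vertex with given position and weight is joined to a random one. -/
noncomputable def meanConnect (p : ConnectionProbability d α θ₁ θ₂) (n : ℕ) (D : Measure ℝ)
    (y : Torus d × ℝ) : ℝ≥0∞ :=
  ∫⁻ x, volume {t : unitInterval | (t : ℝ) < connect p n y x} ∂(volume.prod D)

/-- The number of vertices in `S` that are joined to `u`. -/
noncomputable def degreeIn (p : ConnectionProbability d α θ₁ θ₂) (n : ℕ) (S : Finset ℕ) (u : ℕ)
    (z : MarkSample d) : ℕ :=
  (S.filter fun w => (z.2.2 s(u, w) : ℝ) < connect p n (mark z u) (mark z w)).card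

/-- The generating function of a Bernoulli variable. -/
lemma lintegral_ite_connect (p : ConnectionProbability d α θ₁ θ₂) (n : ℕ) (D : Measure ℝ)
    [IsProbabilityMeasure D] (y : Torus d × ℝ) :
    ∃ q' : ℝ≥0∞, meanConnect p n D y + q' = 1 ∧ ∀ a : ℝ≥0∞,
      ∫⁻ x, (∫⁻ t : unitInterval, if (t : ℝ) < connect p n y x then a else 1) ∂(volume.prod D)
        = meanConnect p n D y * a + q' := by
  have hset : MeasurableSet {z : (Torus d × ℝ) × unitInterval | (z.2 : ℝ) < connect p n y z.1} :=
    (measurableSet_connect p n).preimage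
      (f := fun z : (Torus d × ℝ) × unitInterval => ((y, z.1), z.2)) (by fun_prop)
  have hm1 : Measurable fun x => (volume : Measure unitInterval)
      {t : unitInterval | (t : ℝ) < connect p n y x} := measurable_measure_prodMk_left hset
  have hs : ∀ x, MeasurableSet {t : unitInterval | (t : ℝ) < connect p n y x} := fun x =>
    measurableSet_lt (by fun_prop) measurable_const
  refine ⟨∫⁻ x, volume {t : unitInterval | (t : ℝ) < connect p n y x}ᶜ ∂(volume.prod D), ?_, ?_⟩
  · rw [meanConnect, ← lintegral_add_left hm1]
    simp_rw [fun x => measure_add_measure_compl (μ := (volume : Measure unitInterval)) (hs x)]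
    simp
  · intro a
    rw [meanConnect, ← lintegral_mul_const _ hm1, ← lintegral_add_left (hm1.mul_const a)]
    refine lintegral_congr fun x => ?_
    have : (fun t : unitInterval => if (t : ℝ) < connect p n y x then a else 1)
        = fun t => {t : unitInterval | (t : ℝ) < connect p n y x}.indicator (fun _ => a) t +
          {t : unitInterval | (t : ℝ) < connect p n y x}ᶜ.indicator (fun _ => 1) t := by
      ext t
      by_cases h : (t : ℝ) < connect p n y x <;> simp [Set.indicator, h]
    rw [this, lintegral_add_left (measurable_const.indicator (hs x)),
      lintegral_indicator_const (hs x), lintegral_indicator_const (hs x).compl, one_mul, mul_comm]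

/-- The expected reciprocal of the degree of `u`, weighted by a function of the edge `uv`, given the
position and the weight of `u`. -/
lemma lintegral_inv_degreeIn_le (p : ConnectionProbability d α θ₁ θ₂) (n : ℕ) (D : Measure ℝ)
    [IsProbabilityMeasure D] (u v : ℕ) (S : Finset ℕ) (hu : u ∉ S) (hv : v ∉ S) (huv : u ≠ v)
    (g : Torus d × ℝ → ℝ≥0∞) (hg : Measurable g)
    (h : Torus d × ℝ → Torus d × ℝ → unitInterval → ℝ≥0∞)
    (hh : Measurable fun z : ((Torus d × ℝ) × (Torus d × ℝ)) × unitInterval =>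
      h z.1.1 z.1.2 z.2) :
    ∫⁻ z, g (mark z u) * h (mark z u) (mark z v) (z.2.2 s(u, v)) *
        ((degreeIn p n S u z : ℝ≥0∞) + 1)⁻¹ ∂(sampleLaw d D)
      ≤ ∫⁻ y, g y * (∫⁻ x, (∫⁻ t, h y x t) ∂(volume.prod D)) *
        (((S.card : ℝ≥0∞) + 1) * meanConnect p n D y)⁻¹ ∂(volume.prod D) := by
  classical
  -- The factor at `v` carries the weight `h`; every other vertex contributes `s` if it is joined to
  -- `u` and `1` otherwise. The product over `S` is thus `s` to the power of the degree into `S`.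
  set F : unitInterval → ℕ → Torus d × ℝ → Torus d × ℝ → unitInterval → ℝ≥0∞ := fun s i y x t =>
    if i = v then h y x t else if (t : ℝ) < connect p n y x then ENNReal.ofReal s else 1 with hF
  have hFm : ∀ i, Measurable
      fun q : unitInterval × (((Torus d × ℝ) × (Torus d × ℝ)) × unitInterval) =>
        F q.1 i q.2.1.1 q.2.1.2 q.2.2 := by
    intro i
    by_cases hi : i = v
    · simp only [hF, hi, if_true]
      exact hh.comp measurable_snd
    · simp only [hF, hi, if_false]
      exact Measurable.ite ((measurableSet_connect p n).preimage measurable_snd) (by fun_prop)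
        measurable_const
  have hFz : ∀ i, Measurable fun q : MarkSample d × unitInterval =>
      F q.2 i (mark q.1 u) (mark q.1 i) (q.1.2.2 s(u, i)) := fun i =>
    (hFm i).comp (g := fun q : unitInterval × (((Torus d × ℝ) × (Torus d × ℝ)) × unitInterval) =>
        F q.1 i q.2.1.1 q.2.1.2 q.2.2)
      (f := fun q : MarkSample d × unitInterval =>
        (q.2, ((mark q.1 u, mark q.1 i), q.1.2.2 s(u, i)))) (by fun_prop)
  have hpt : ∀ z : MarkSample d, g (mark z u) * h (mark z u) (mark z v) (z.2.2 s(u, v)) *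
        ((degreeIn p n S u z : ℝ≥0∞) + 1)⁻¹
      = ∫⁻ s : unitInterval, g (mark z u) *
        ∏ i ∈ insert v S, F s i (mark z u) (mark z i) (z.2.2 s(u, i)) := by
    intro z
    rw [← lintegral_unitInterval_pow, ← lintegral_const_mul _ (by fun_prop)]
    refine lintegral_congr fun s => ?_
    rw [Finset.prod_insert hv, mul_assoc]
    congr 2
    · simp [hF]
    · rw [degreeIn, ← Finset.prod_const, Finset.prod_filter]
      refine Finset.prod_congr rfl fun i hi => ?_
      have : i ≠ v := by rintro rfl; exact hv hi
      simp [hF, this]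
  simp_rw [hpt]
  have hm : Measurable fun q : MarkSample d × unitInterval => g (mark q.1 u) *
      ∏ i ∈ insert v S, F q.2 i (mark q.1 u) (mark q.1 i) (q.1.2.2 s(u, i)) :=
    Measurable.mul (by fun_prop) (Finset.measurable_fun_prod _ fun i _ => hFz i)
  rw [lintegral_lintegral_swap hm.aemeasurable]
  have hsplit : ∀ s : unitInterval, ∫⁻ z, g (mark z u) *
      ∏ i ∈ insert v S, F s i (mark z u) (mark z i) (z.2.2 s(u, i)) ∂(sampleLaw d D)
      = ∫⁻ y, g y * ∏ i ∈ insert v S, ∫⁻ x, (∫⁻ t, F s i y x t) ∂(volume.prod D)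
        ∂(volume.prod D) := fun s =>
    lintegral_sampleLaw_split D u (insert v S) (by simp [hu, huv]) g hg (F s)
      (fun i => (hFm i).comp measurable_prodMk_left)
  simp_rw [hsplit]
  have hm2 : Measurable fun q : unitInterval × (Torus d × ℝ) => g q.2 *
      ∏ i ∈ insert v S, ∫⁻ x, (∫⁻ t, F q.1 i q.2 x t) ∂(volume.prod D) := by
    refine Measurable.mul (by fun_prop) (Finset.measurable_fun_prod _ fun i _ => ?_)
    have h1 : Measurable fun q : (unitInterval × (Torus d × ℝ)) × (Torus d × ℝ) =>
        ∫⁻ t, F q.1.1 i q.1.2 q.2 t :=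
      Measurable.lintegral_prod_right' (f := fun r : ((unitInterval × (Torus d × ℝ)) ×
        (Torus d × ℝ)) × unitInterval => F r.1.1.1 i r.1.1.2 r.1.2 r.2)
        ((hFm i).comp (f := fun r : ((unitInterval × (Torus d × ℝ)) ×
        (Torus d × ℝ)) × unitInterval => (r.1.1.1, ((r.1.1.2, r.1.2), r.2))) (by fun_prop))
    exact h1.lintegral_prod_right'
  rw [lintegral_lintegral_swap hm2.aemeasurable]
  refine lintegral_mono fun y => ?_
  -- With the mark of `u` fixed, the vertices of `S` are joined to `u` independently with
  -- probability `meanConnect p n D y`.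
  obtain ⟨q', hq, hq'⟩ := lintegral_ite_connect p n D y
  have hprod : ∀ s : unitInterval, g y *
      ∏ i ∈ insert v S, ∫⁻ x, (∫⁻ t, F s i y x t) ∂(volume.prod D)
      = g y * (∫⁻ x, (∫⁻ t, h y x t) ∂(volume.prod D)) *
        (meanConnect p n D y * ENNReal.ofReal s + q') ^ S.card := by
    intro s
    rw [Finset.prod_insert hv, ← mul_assoc, ← Finset.prod_const]
    congr 1
    · simp [hF]
    · refine Finset.prod_congr rfl fun i hi => ?_
      have : i ≠ v := by rintro rfl; exact hv hi
      simp only [hF, this, if_false]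
      exact hq' _
  simp_rw [hprod]
  rw [lintegral_const_mul _ (by fun_prop)]
  gcongr
  exact lintegral_unitInterval_affine_pow _ _ hq _

/-! ### Bounds for connection probabilities -/

lemma ballVolume_pos (d : ℕ) {r : ℝ} (hr : 0 < r) : 0 < ballVolume d r := by
  rw [ballVolume_eq d hr.le]
  exact pow_pos (lt_min one_pos (by positivity)) d

lemma ballVolume_mono (d : ℕ) {r s : ℝ} (hr : 0 ≤ r) (hrs : r ≤ s) :
    ballVolume d r ≤ ballVolume d s := by
  rw [ballVolume_eq d hr, ballVolume_eq d (hr.trans hrs)]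
  exact pow_le_pow_left₀ (le_min zero_le_one (by positivity))
    (min_le_min le_rfl (by linarith)) d

lemma ae_mark_of_ae {D : Measure ℝ} [IsProbabilityMeasure D] {P : ℝ → Prop}
    (h : ∀ᵐ w ∂D, P w) : ∀ᵐ x ∂((volume : Measure (Torus d)).prod D), P x.2 :=
  Measure.quasiMeasurePreserving_snd.ae h

/-- A vertex of weight `w` is joined to a random vertex with probability at least of order
`w / n`. -/
lemma le_meanConnect (hd : 1 ≤ d) (hα : 0 < α) (p : ConnectionProbability d α θ₁ θ₂) {n : ℕ}
    (hn : 1 ≤ n) {D : Measure ℝ} [IsProbabilityMeasure D] (hD : ∀ᵐ w ∂D, 1 ≤ w)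
    (hθ0 : 0 ≤ θ₁) (hθ1 : θ₁ ≤ 1) {y : Torus d × ℝ} (hy1 : 1 ≤ y.2) (hyn : y.2 ≤ n) :
    ENNReal.ofReal (θ₁ * (y.2 / n)) ≤ meanConnect p n D y := by
  have hn0 : (0 : ℝ) < n := by exact_mod_cast hn
  have hd0 : d ≠ 0 := by omega
  set a := y.2 / n with ha
  have ha0 : 0 < a := by positivity
  have ha1 : a ≤ 1 := (div_le_one hn0).mpr hyn
  -- The radius whose ball has volume `y.2 / n`. Inside it `connectionScale` equals `1`, since the
  -- other weight is at least `1`.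
  set ρ := a ^ (1 / (d : ℝ)) / 2 with hρ
  have hρ0 : 0 < ρ := by positivity
  have h2ρ : (2 * ρ) ^ d = a := by
    rw [hρ, mul_div_cancel₀ _ (two_ne_zero), one_div, Real.rpow_inv_natCast_pow ha0.le hd0]
  have h2ρ1 : 2 * ρ ≤ 1 := by
    by_contra hlt
    have := one_lt_pow₀ (not_le.mp hlt) hd0
    linarith
  -- The null set of the centre is removed because the bounds on `prob` require distinct positions.
  have hvol : (volume : Measure (Torus d)) (Metric.closedBall y.1 ρ \ {y.1})
      = ENNReal.ofReal a := by
    have h0 : (volume : Measure (Torus d)) {y.1} = 0 := by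
      rw [← Metric.closedBall_zero, volume_closedBall_torus d _ le_rfl]
      simp [hd0]
    rw [measure_sdiff_null h0, volume_closedBall_torus d _ hρ0.le,
      min_eq_right h2ρ1, h2ρ]
  have hDI : D (Set.Ici 1) = 1 := prob_compl_eq_zero_iff measurableSet_Ici |>.mp (mem_ae_iff.mp hD)
  set B : Set (Torus d × ℝ) := (Metric.closedBall y.1 ρ \ {y.1}) ×ˢ Set.Ici 1
  have hB : MeasurableSet B :=
    (measurableSet_closedBall.diff (measurableSet_singleton _)).prod
      measurableSet_Ici
  have hone : ∀ x ∈ B, ENNReal.ofReal θ₁ ≤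
      (volume : Measure unitInterval) {t | (t : ℝ) < connect p n y x} := by
    rintro x ⟨⟨hx, hne⟩, hx1⟩
    refine (le_volume_unitInterval_lt hθ1).trans (measure_mono fun t (ht : (t : ℝ) < θ₁) => ?_)
    have hne' : y.1 ≠ x.1 := fun h => hne h.symm
    have hx2 : (1 : ℝ) ≤ x.2 := hx1
    have hdist : ‖y.1 - x.1‖ ≤ ρ := by
      rw [← dist_eq_norm, dist_comm]; exact hx
    have hpos : 0 < ‖y.1 - x.1‖ := norm_pos_iff.mpr (sub_ne_zero.mpr hne')
    have hV0 := ballVolume_pos d hpos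
    have hV : ballVolume d ‖y.1 - x.1‖ ≤ a := by
      refine (ballVolume_mono d hpos.le hdist).trans_eq ?_
      rw [ballVolume_eq d hρ0.le, min_eq_right h2ρ1, h2ρ]
    have hscale : connectionScale d α n y.1 x.1 y.2 x.2 = 1 := by
      refine min_eq_right (Real.one_le_rpow ?_ hα.le)
      rw [one_le_div (by positivity)]
      calc (n : ℝ) * ballVolume d ‖y.1 - x.1‖ ≤ n * a := by gcongr
        _ = y.2 * 1 := by rw [ha]; field_simp
        _ ≤ y.2 * x.2 := by gcongr
    have := p.lower n y.1 x.1 y.2 x.2 hn hne' hy1 hx2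
    rw [hscale, mul_one] at this
    exact lt_of_lt_of_le ht this
  calc ENNReal.ofReal (θ₁ * a) = ENNReal.ofReal θ₁ * (volume.prod D) B := by
        rw [Measure.prod_prod, hvol, hDI, mul_one, ENNReal.ofReal_mul hθ0]
    _ = ∫⁻ x in B, ENNReal.ofReal θ₁ ∂(volume.prod D) := by rw [setLIntegral_const]
    _ ≤ ∫⁻ x in B, volume {t : unitInterval | (t : ℝ) < connect p n y x} ∂(volume.prod D) :=
        setLIntegral_mono' hB hone
    _ ≤ _ := setLIntegral_le_lintegral _ _

/-- An upper bound for the connection probability of distant vertices. -/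
lemma connect_le_of_far (p : ConnectionProbability d α θ₁ θ₂) {n : ℕ} (hn : 1 ≤ n)
    (hθ : θ₂ ≤ 1) {r β : ℝ} (hr : 0 < r) (hβ0 : 0 ≤ β) (hβ : β ≤ α) {y x : Torus d × ℝ}
    (hy : 1 ≤ y.2) (hx : 1 ≤ x.2) (hfar : r < ‖y.1 - x.1‖) :
    connect p n y x ≤ (y.2 * x.2 / (n * ballVolume d r)) ^ β := by
  have hn0 : (0 : ℝ) < n := by exact_mod_cast hn
  have hne : y.1 ≠ x.1 := by
    intro h
    rw [h, sub_self, norm_zero] at hfar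
    linarith
  have hV0 := ballVolume_pos d hr
  have hV1 := ballVolume_mono d hr.le hfar.le
  have hV2 := hV0.trans_le hV1
  have hup := p.upper n y.1 x.1 y.2 x.2 hn hne hy hx
  set t := y.2 * x.2 / (n * ballVolume d ‖y.1 - x.1‖) with ht
  set T := y.2 * x.2 / (n * ballVolume d r) with hT
  have ht0 : 0 ≤ t := by positivity
  have htT : t ≤ T := by rw [ht, hT]; gcongr
  have hscale : connectionScale d α n y.1 x.1 y.2 x.2 = min (t ^ α) 1 := rfl
  have h0 : 0 ≤ min (t ^ α) 1 := le_min (by positivity) zero_le_one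
  have h1 : connect p n y x ≤ min (t ^ α) 1 := by
    refine hup.trans ?_
    rw [hscale]
    exact mul_le_of_le_one_left h0 hθ
  refine h1.trans ?_
  -- The cap `1` permits lowering the exponent from `α` to `β`: for `T ≥ 1` the bound is trivial,
  -- for `T < 1` a smaller exponent gives a larger power.
  rcases le_or_gt 1 T with h | h
  · exact (min_le_right _ _).trans (Real.one_le_rpow h hβ0)
  · refine (min_le_left _ _).trans ?_
    have hT0 : 0 < T := by positivity
    exact (Real.rpow_le_rpow ht0 htT (hβ0.trans hβ)).trans
      (Real.rpow_le_rpow_of_exponent_ge hT0 h.le hβ)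

/-! ### Contacts along long edges, in expectation -/

/-- The indicator that `x` has weight at most `M`, has distance more than `r` from `y`, and is
joined to `y`. -/
noncomputable def longEdge (p : ConnectionProbability d α θ₁ θ₂) (n : ℕ) (M r : ℝ)
    (y x : Torus d × ℝ) (t : unitInterval) : ℝ≥0∞ :=
  if x.2 ≤ M ∧ r < ‖y.1 - x.1‖ ∧ (t : ℝ) < connect p n y x then 1 else 0

lemma measurable_longEdge (p : ConnectionProbability d α θ₁ θ₂) (n : ℕ) (M r : ℝ) :
    Measurable fun z : ((Torus d × ℝ) × (Torus d × ℝ)) × unitInterval =>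
      longEdge p n M r z.1.1 z.1.2 z.2 := by
  have h1 : MeasurableSet {z : ((Torus d × ℝ) × (Torus d × ℝ)) × unitInterval | z.1.2.2 ≤ M} :=
    measurableSet_le (by fun_prop) measurable_const
  have h2 : MeasurableSet {z : ((Torus d × ℝ) × (Torus d × ℝ)) × unitInterval |
      r < ‖z.1.1.1 - z.1.2.1‖} := measurableSet_lt measurable_const (by fun_prop)
  exact Measurable.ite (h1.inter (h2.inter (measurableSet_connect p n))) measurable_const
    measurable_const

/-- The `β`-th moment of the weights may be infinite; the cap `M` trades the excess `β - γ` for a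
power of `M`, leaving a `γ`-th moment. -/
lemma lintegral_longEdge_le (p : ConnectionProbability d α θ₁ θ₂) {n : ℕ} (hn : 1 ≤ n)
    (hθ : θ₂ ≤ 1) {D : Measure ℝ} [IsProbabilityMeasure D] (hD : ∀ᵐ w ∂D, 1 ≤ w) {M r β γ : ℝ}
    (hr : 0 < r) (hβ0 : 0 ≤ β) (hβ : β ≤ α) (hγβ : γ ≤ β) {y : Torus d × ℝ}
    (hy : 1 ≤ y.2) :
    ∫⁻ x, (∫⁻ t, longEdge p n M r y x t) ∂(volume.prod D) ≤
      ENNReal.ofReal (y.2 ^ β * (n * ballVolume d r) ^ (-β) * M ^ (β - γ)) *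
        ∫⁻ w, ENNReal.ofReal (w ^ γ) ∂D := by
  have hn0 : (0 : ℝ) < n := by exact_mod_cast hn
  have hV0 := ballVolume_pos d hr
  have hmγ : ∫⁻ w, ENNReal.ofReal (w ^ γ) ∂D
      = ∫⁻ x : Torus d × ℝ, ENNReal.ofReal (x.2 ^ γ) ∂(volume.prod D) :=
    (measurePreserving_snd.lintegral_comp (f := fun w : ℝ => ENNReal.ofReal (w ^ γ))
      (by fun_prop)).symm
  rw [hmγ, ← lintegral_const_mul _ (by fun_prop)]
  refine lintegral_mono_ae ?_
  filter_upwards [ae_mark_of_ae hD] with x hx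
  by_cases h : x.2 ≤ M ∧ r < ‖y.1 - x.1‖
  · have hle : ∫⁻ t, longEdge p n M r y x t ≤ ENNReal.ofReal (connect p n y x) := by
      refine le_trans ?_ (volume_unitInterval_lt_le _)
      have hs : MeasurableSet {t : unitInterval | (t : ℝ) < connect p n y x} :=
        measurableSet_lt measurable_subtype_coe measurable_const
      rw [← lintegral_indicator_one hs]
      refine lintegral_mono fun t => ?_
      simp [longEdge, h, Set.indicator]
    refine hle.trans ?_
    have hx0 : 0 < x.2 := by linarith
    rw [← ENNReal.ofReal_mul (by have : 0 ≤ M := by linarith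
                                 positivity)]
    refine ENNReal.ofReal_le_ofReal
      ((connect_le_of_far p hn hθ hr hβ0 hβ hy hx h.2).trans ?_)
    rw [Real.div_rpow (by positivity) (by positivity), Real.mul_rpow (by positivity) hx0.le,
      Real.rpow_neg (by positivity), div_eq_mul_inv]
    have h1 : x.2 ^ β ≤ M ^ (β - γ) * x.2 ^ γ := by
      calc x.2 ^ β = x.2 ^ (β - γ) * x.2 ^ γ := by rw [← Real.rpow_add hx0]; ring_nf
        _ ≤ M ^ (β - γ) * x.2 ^ γ := by
          gcongr
          exact h.1
    calc y.2 ^ β * x.2 ^ β * ((n * ballVolume d r) ^ β)⁻¹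
        ≤ y.2 ^ β * (M ^ (β - γ) * x.2 ^ γ) * ((n * ballVolume d r) ^ β)⁻¹ := by gcongr
      _ = _ := by ring
  · have : ∀ t, longEdge p n M r y x t = 0 := fun t => if_neg fun h' => h ⟨h'.1, h'.2.1⟩
    simp [this]

/-- The expected number of contacts of `u` along a long edge to `v`, in one round, with both weights
at most `M`. -/
lemma lintegral_longEdge_inv_degree_le (hd : 1 ≤ d) (hα : 0 < α)
    (p : ConnectionProbability d α θ₁ θ₂) {n : ℕ}
    (hn : 1 ≤ n) (hθ0 : 0 < θ₁) (hθ1 : θ₁ ≤ 1) (hθ : θ₂ ≤ 1) {D : Measure ℝ}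
    [IsProbabilityMeasure D]
    (hD : ∀ᵐ w ∂D, 1 ≤ w) {M r β γ : ℝ} (hMn : M ≤ n) (hr : 0 < r) (hβ0 : 0 ≤ β) (hβ : β ≤ α)
    (hγβ : γ ≤ β) (hβγ : β - 1 ≤ γ) (u v : ℕ) (S : Finset ℕ) (hu : u ∉ S) (hv : v ∉ S)
    (huv : u ≠ v) :
    ∫⁻ z, (if (mark z u).2 ≤ M then 1 else 0) *
      longEdge p n M r (mark z u) (mark z v) (z.2.2 s(u, v)) *
        ((degreeIn p n S u z : ℝ≥0∞) + 1)⁻¹ ∂(sampleLaw d D)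
      ≤ ((S.card : ℝ≥0∞) + 1)⁻¹ *
        ENNReal.ofReal (n / θ₁ * (n * ballVolume d r) ^ (-β) * M ^ (β - γ)) *
        (∫⁻ w, ENNReal.ofReal (w ^ γ) ∂D) ^ 2 := by
  have hn0 : (0 : ℝ) < n := by exact_mod_cast hn
  have hV0 := ballVolume_pos d hr
  set m := ∫⁻ w, ENNReal.ofReal (w ^ γ) ∂D with hm
  set k : ℝ≥0∞ := (S.card : ℝ≥0∞) + 1 with hk
  set A := (n * ballVolume d r) ^ (-β) * M ^ (β - γ) with hA
  refine (lintegral_inv_degreeIn_le p n D u v S hu hv huv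
    (fun y => if y.2 ≤ M then 1 else 0)
    (Measurable.ite (measurableSet_le (by fun_prop) measurable_const) measurable_const
      measurable_const) (longEdge p n M r) (measurable_longEdge p n M r)).trans ?_
  have hmγ : m = ∫⁻ x : Torus d × ℝ, ENNReal.ofReal (x.2 ^ γ) ∂(volume.prod D) :=
    (measurePreserving_snd.lintegral_comp (f := fun w : ℝ => ENNReal.ofReal (w ^ γ))
      (by fun_prop)).symm
  rw [sq, ← mul_assoc]
  nth_rewrite 2 [hmγ]
  rw [← lintegral_const_mul _ (by fun_prop)]
  refine lintegral_mono_ae ?_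
  filter_upwards [ae_mark_of_ae hD] with y hy
  by_cases hyM : y.2 ≤ M
  · have hy0 : 0 < y.2 := by linarith
    have hM0 : 0 < M := by linarith
    have hA0 : 0 ≤ A := by positivity
    have h1 := lintegral_longEdge_le p (M := M) hn hθ hD hr hβ0 hβ hγβ hy
    have h2 := le_meanConnect hd hα p hn hD hθ0.le hθ1 hy (hyM.trans hMn)
    -- The reciprocal degree gains a factor `1 / y.2`. This is the essential saving over merely
    -- counting long edges.
    have h3 : (k * meanConnect p n D y)⁻¹ ≤ k⁻¹ * ENNReal.ofReal (n / (θ₁ * y.2)) := by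
      have : ENNReal.ofReal (n / (θ₁ * y.2)) = (ENNReal.ofReal (θ₁ * (y.2 / n)))⁻¹ := by
        rw [← ENNReal.ofReal_inv_of_pos (by positivity)]
        congr 1
        field_simp
      rw [this, ← ENNReal.mul_inv (by simp [hk]) (by simp [hk])]
      gcongr
    rw [if_pos hyM, one_mul]
    calc (∫⁻ x, (∫⁻ t, longEdge p n M r y x t) ∂(volume.prod D)) * (k * meanConnect p n D y)⁻¹
        ≤ (ENNReal.ofReal (y.2 ^ β * (n * ballVolume d r) ^ (-β) * M ^ (β - γ)) * m) *
          (k⁻¹ * ENNReal.ofReal (n / (θ₁ * y.2))) := by gcongr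
      _ = k⁻¹ * (ENNReal.ofReal (y.2 ^ β * (n * ballVolume d r) ^ (-β) * M ^ (β - γ)) *
          ENNReal.ofReal (n / (θ₁ * y.2))) * m := by ring
      _ ≤ k⁻¹ * (ENNReal.ofReal (n / θ₁ * (n * ballVolume d r) ^ (-β) * M ^ (β - γ)) *
          ENNReal.ofReal (y.2 ^ γ)) * m := by
        gcongr k⁻¹ * ?_ * m
        rw [← ENNReal.ofReal_mul (by positivity), ← ENNReal.ofReal_mul (by positivity)]
        refine ENNReal.ofReal_le_ofReal ?_
        -- After that gain only the power `β - 1 ≤ γ` of this weight remains, so no further power of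
        -- `M` is lost.
        have h4 : y.2 ^ β / y.2 ≤ y.2 ^ γ := by
          rw [← Real.rpow_sub_one hy0.ne']
          exact Real.rpow_le_rpow_of_exponent_le hy hβγ
        calc y.2 ^ β * (n * ballVolume d r) ^ (-β) * M ^ (β - γ) * (n / (θ₁ * y.2))
            = n / θ₁ * A * (y.2 ^ β / y.2) := by rw [hA]; field_simp
          _ ≤ n / θ₁ * A * y.2 ^ γ := by gcongr
          _ = _ := by rw [hA]; ring
      _ = _ := by ring
  · rw [if_neg hyM, zero_mul, zero_mul]
    exact zero_le

/-! ### Number of vertices in a ball -/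

/-- The number of vertices in `S` within distance `R` of `u`. -/
noncomputable def nearIn (R : ℝ) (S : Finset ℕ) (u : ℕ) (z : MarkSample d) : ℕ :=
  (S.filter fun w => ‖z.1 w - z.1 u‖ ≤ R).card

/-- Chernoff's bound for the number of vertices close to `u`. -/
lemma sampleLaw_nearIn_ge_le (D : Measure ℝ) [IsProbabilityMeasure D] {R : ℝ} (hR : 0 ≤ R)
    (u : ℕ) (S : Finset ℕ) (hu : u ∉ S) (a : ℝ) :
    sampleLaw d D {z | a ≤ nearIn R S u z} ≤
      ENNReal.ofReal (Real.exp (-a)) *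
        ENNReal.ofReal (1 + Real.exp 1 * (2 * R) ^ d) ^ S.card := by
  -- Exponential Markov inequality with parameter `1`: given the position of `u`, each vertex of `S`
  -- independently contributes a factor with mean at most `1 + e (2 R) ^ d`.
  set e := ENNReal.ofReal (Real.exp 1) with he
  set f : ℕ → Torus d × ℝ → Torus d × ℝ → unitInterval → ℝ≥0∞ :=
    fun _ y x _ => if ‖x.1 - y.1‖ ≤ R then e else 1 with hf
  have hfm : Measurable fun z : ((Torus d × ℝ) × (Torus d × ℝ)) × unitInterval =>
      f 0 z.1.1 z.1.2 z.2 :=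
    Measurable.ite (measurableSet_le (by fun_prop) measurable_const) measurable_const
      measurable_const
  have hsplit := lintegral_sampleLaw_split D u S hu (fun _ => 1) measurable_const f
    (fun _ => hfm)
  have hball : ∀ y : Torus d × ℝ,
      ∫⁻ x, (∫⁻ t : unitInterval, f 0 y x t) ∂((volume : Measure (Torus d)).prod D)
      ≤ ENNReal.ofReal (1 + Real.exp 1 * (2 * R) ^ d) := by
    intro y
    have hB : MeasurableSet {x : Torus d × ℝ | ‖x.1 - y.1‖ ≤ R} :=
      measurableSet_le (by fun_prop) measurable_const
    have hle : ∀ x : Torus d × ℝ, (∫⁻ t : unitInterval, f 0 y x t) ≤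
        1 + {x : Torus d × ℝ | ‖x.1 - y.1‖ ≤ R}.indicator (fun _ => e) x := by
      intro x
      by_cases h : ‖x.1 - y.1‖ ≤ R <;> simp [hf, h]
    refine (lintegral_mono hle).trans ?_
    rw [lintegral_add_left measurable_const, lintegral_indicator_const hB]
    have hprod : {x : Torus d × ℝ | ‖x.1 - y.1‖ ≤ R}
        = Metric.closedBall y.1 R ×ˢ Set.univ := by
      ext x
      simp [dist_eq_norm]
    rw [hprod, Measure.prod_prod, volume_closedBall_torus d _ hR,
      ENNReal.ofReal_add zero_le_one (by positivity), ENNReal.ofReal_mul (by positivity)]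
    simp only [lintegral_const, measure_univ, mul_one, ENNReal.ofReal_one]
    gcongr
    exact min_le_right _ _
  have hE : ∫⁻ z, e ^ nearIn R S u z ∂(sampleLaw d D)
      ≤ ENNReal.ofReal (1 + Real.exp 1 * (2 * R) ^ d) ^ S.card := by
    have hpt : ∀ z : MarkSample d, e ^ nearIn R S u z
        = 1 * ∏ i ∈ S, f i (mark z u) (mark z i) (z.2.2 s(u, i)) := by
      intro z
      rw [one_mul, nearIn, ← Finset.prod_const, Finset.prod_filter]
      rfl
    simp_rw [hpt]
    rw [hsplit]
    calc _ ≤ ∫⁻ y : Torus d × ℝ, ENNReal.ofReal (1 + Real.exp 1 * (2 * R) ^ d) ^ S.card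
          ∂(volume.prod D) := by
          refine lintegral_mono fun y => ?_
          rw [one_mul, ← Finset.prod_const]
          exact Finset.prod_le_prod' fun i _ => hball y
      _ = _ := by simp
  have hsub : {z : MarkSample d | a ≤ nearIn R S u z}
      ⊆ {z | ENNReal.ofReal (Real.exp a) ≤ e ^ nearIn R S u z} := by
    intro z hz
    simp only [Set.mem_ofPred_eq] at hz ⊢
    rw [he, ← ENNReal.ofReal_pow (by positivity), ← Real.exp_nat_mul, mul_one]
    exact ENNReal.ofReal_le_ofReal (Real.exp_le_exp.mpr hz)
  have hmk := meas_ge_le_lintegral_div (μ := sampleLaw d D)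
    (f := fun z : MarkSample d => e ^ nearIn R S u z) ?_
    (ε := ENNReal.ofReal (Real.exp a)) (by simp [Real.exp_pos]) ENNReal.ofReal_ne_top
  · refine (measure_mono hsub).trans (hmk.trans ?_)
    rw [ENNReal.div_eq_inv_mul, Real.exp_neg, ENNReal.ofReal_inv_of_pos (Real.exp_pos a)]
    gcongr
  · have : Measurable fun z : MarkSample d =>
        ∏ i ∈ S, f i (mark z u) (mark z i) (z.2.2 s(u, i)) :=
      Finset.measurable_fun_prod _ fun i _ => hfm.comp
        (f := fun z : MarkSample d => ((mark z u, mark z i), z.2.2 s(u, i))) (by fun_prop)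
    refine Measurable.aemeasurable ?_
    convert this using 2 with z
    rw [nearIn, ← Finset.prod_const, Finset.prod_filter]
    rfl

/-! ### Probability of a contact along a long edge -/

lemma uniformChoice_singleton_le (A : Finset ℕ) (v : ℕ) :
    uniformChoice A {v} ≤ (A.card : ℝ≥0∞)⁻¹ := by
  rcases A.eq_empty_or_nonempty with rfl | h
  · simp
  · rw [uniformChoice, dif_pos h, PMF.toMeasure_apply_singleton _ _ (measurableSet_singleton v),
      PMF.uniformOfFinset_apply]
    split
    · rfl
    · exact zero_le

instance : IsProbabilityMeasure choiceLaw := by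
  unfold choiceLaw
  infer_instance

lemma choiceLaw_eq_le (q : ℕ × ℕ × Finset ℕ) (v : ℕ) :
    choiceLaw {c | c q = v} ≤ (q.2.2.card : ℝ≥0∞)⁻¹ := by
  have h := (measurePreserving_eval_infinitePi
    (fun q : ℕ × ℕ × Finset ℕ => uniformChoice q.2.2) q).measure_preimage
    (measurableSet_singleton v).nullMeasurableSet
  exact h.trans_le (uniformChoice_singleton_le _ _)

/-- Bound for the probability of a given contact when the neighbourhood is random. -/
lemma prod_choiceLaw_contact_le {Ω : Type*} [MeasurableSpace Ω] (Q : Measure Ω)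
    [IsProbabilityMeasure Q] (t u v : ℕ) (F : Finset (Finset ℕ)) (N : Ω → Finset ℕ)
    (hN : ∀ A, MeasurableSet {z | N z = A}) (hNF : ∀ z, N z ∈ F) (G : Set Ω)
    (hG : MeasurableSet G) :
    (Q.prod choiceLaw) {ω | ω.1 ∈ G ∧ ω.2 (t, u, N ω.1) = v} ≤
      ∫⁻ z in G, ((N z).card : ℝ≥0∞)⁻¹ ∂Q := by
  -- Splitting by the value `A` of the neighbourhood gives product sets: for fixed `A` the choice
  -- variable is a fixed coordinate, independent of the graph.
  have hsub : {ω : Ω × ChoiceSample | ω.1 ∈ G ∧ ω.2 (t, u, N ω.1) = v} ⊆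
      ⋃ A ∈ F, (G ∩ {z | N z = A}) ×ˢ {c : ChoiceSample | c (t, u, A) = v} := by
    rintro ⟨z, c⟩ ⟨hz, hc⟩
    simp only [Set.mem_iUnion]
    exact ⟨N z, hNF z, ⟨hz, rfl⟩, hc⟩
  refine (measure_mono hsub).trans ((measure_biUnion_finset_le _ _).trans ?_)
  calc ∑ A ∈ F, (Q.prod choiceLaw) ((G ∩ {z | N z = A}) ×ˢ {c : ChoiceSample | c (t, u, A) = v})
      ≤ ∑ A ∈ F, ∫⁻ z, (G ∩ {z | N z = A}).indicator (fun _ => (A.card : ℝ≥0∞)⁻¹) z ∂Q := by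
        refine Finset.sum_le_sum fun A _ => ?_
        rw [Measure.prod_prod, lintegral_indicator_const (hG.inter (hN A)), mul_comm]
        gcongr
        exact choiceLaw_eq_le (t, u, A) v
    _ = ∫⁻ z, ∑ A ∈ F, (G ∩ {z | N z = A}).indicator (fun _ => (A.card : ℝ≥0∞)⁻¹) z ∂Q :=
        (lintegral_finsetSum _ fun A _ => measurable_const.indicator (hG.inter (hN A))).symm
    _ = ∫⁻ z, G.indicator (fun z => ((N z).card : ℝ≥0∞)⁻¹) z ∂Q := by
        refine lintegral_congr fun z => ?_
        rw [Finset.sum_eq_single_of_mem (N z) (hNF z)]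
        · by_cases hz : z ∈ G <;> simp [hz]
        · intro A _ hA
          exact Set.indicator_of_notMem (fun h => hA h.2.symm) _
    _ = _ := lintegral_indicator hG _

lemma measurableSet_graph_adj (p : ConnectionProbability d α θ₁ θ₂) (n m u v : ℕ) :
    MeasurableSet {z : MarkSample d | (graph p n (m, z)).Adj u v} := by
  have h : MeasurableSet {z : MarkSample d |
      (z.2.2 s(u, v) : ℝ) < connect p n (mark z u) (mark z v)} :=
    (measurableSet_connect p n).preimage
      (f := fun z : MarkSample d => ((mark z u, mark z v), z.2.2 s(u, v))) (by fun_prop)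
  exact (MeasurableSet.const (u ≠ v)).inter ((MeasurableSet.const (u < m)).inter
    ((MeasurableSet.const (v < m)).inter h))

lemma neighbours_subset_range (N : ℕ) (G : SimpleGraph ℕ) (v : ℕ) :
    neighbours N G v ⊆ Finset.range N := by
  classical exact fun _ hw => (Finset.mem_filter.mp hw).1

lemma measurableSet_neighbours_eq (p : ConnectionProbability d α θ₁ θ₂) (n m u : ℕ)
    (A : Finset ℕ) :
    MeasurableSet {z : MarkSample d | neighbours m (graph p n (m, z)) u = A} := by
  have : {z : MarkSample d | neighbours m (graph p n (m, z)) u = A}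
      = ⋂ w : ℕ, {z : MarkSample d | (w < m ∧ (graph p n (m, z)).Adj u w) ↔ w ∈ A} := by
    ext z
    simp [neighbours, Finset.ext_iff]
  rw [this]
  refine MeasurableSet.iInter fun w => ?_
  exact ((MeasurableSet.const (w < m)).inter (measurableSet_graph_adj p n m u w)).iff
    (MeasurableSet.const (w ∈ A))

/-- The extra `1` is `v` itself. Leaving `v` out of the degree keeps the remaining edges at `u`
independent of the edge `uv`, given the mark of `u`. -/
lemma degreeIn_add_one_le_card_neighbours (p : ConnectionProbability d α θ₁ θ₂) (n m u v : ℕ)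
    (z : MarkSample d) (h : (graph p n (m, z)).Adj u v) :
    degreeIn p n (((Finset.range m).erase u).erase v) u z + 1
      ≤ (neighbours m (graph p n (m, z)) u).card := by
  classical
  rw [degreeIn, ← Finset.card_insert_of_notMem (a := v) (by simp)]
  refine Finset.card_le_card fun w hw => ?_
  simp only [neighbours, Finset.mem_filter, Finset.mem_range]
  rcases Finset.mem_insert.mp hw with rfl | hw
  · exact ⟨h.2.2.1, h⟩
  · simp only [Finset.mem_filter, Finset.mem_erase, Finset.mem_range] at hw
    exact ⟨hw.1.2.2, hw.1.2.1.symm, h.2.1, hw.1.2.2, hw.2⟩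

/-- The event that `u` contacts `v` in round `t` along an edge of length more than `r`, where both
weights are at most `M`. -/
def longContact (p : ConnectionProbability d α θ₁ θ₂) (n m : ℕ) (M r : ℝ) (t u v : ℕ) :
    Set (MarkSample d × ChoiceSample) :=
  {ω | ω.1 ∈ {z : MarkSample d | (mark z u).2 ≤ M ∧ (mark z v).2 ≤ M ∧ r < ‖z.1 u - z.1 v‖ ∧
    (graph p n (m, z)).Adj u v} ∧ contact m (graph p n (m, ω.1)) ω.2 t u = v}

lemma longContact_le (hd : 1 ≤ d) (hα : 0 < α)
    (p : ConnectionProbability d α θ₁ θ₂) {n : ℕ}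
    (hn : 1 ≤ n) (hθ0 : 0 < θ₁) (hθ1 : θ₁ ≤ 1) (hθ : θ₂ ≤ 1) {D : Measure ℝ}
    [IsProbabilityMeasure D]
    (hD : ∀ᵐ w ∂D, 1 ≤ w) {M r β γ : ℝ} (hMn : M ≤ n) (hr : 0 < r) (hβ0 : 0 ≤ β) (hβ : β ≤ α)
    (hγβ : γ ≤ β) (hβγ : β - 1 ≤ γ) (m t u v : ℕ) (huv : u ≠ v) (hu : u < m) (hv : v < m) :
    ((sampleLaw d D).prod choiceLaw) (longContact p n m M r t u v) ≤
      ((m - 1 : ℕ) : ℝ≥0∞)⁻¹ *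
        (ENNReal.ofReal (n / θ₁ * (n * ballVolume d r) ^ (-β) * M ^ (β - γ)) *
        (∫⁻ w, ENNReal.ofReal (w ^ γ) ∂D) ^ 2) := by
  set G := {z : MarkSample d | (mark z u).2 ≤ M ∧ (mark z v).2 ≤ M ∧ r < ‖z.1 u - z.1 v‖ ∧
    (graph p n (m, z)).Adj u v} with hG
  have hGm : MeasurableSet G := by
    have h1 : MeasurableSet {z : MarkSample d | (mark z u).2 ≤ M} :=
      measurableSet_le (by fun_prop) measurable_const
    have h2 : MeasurableSet {z : MarkSample d | (mark z v).2 ≤ M} :=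
      measurableSet_le (by fun_prop) measurable_const
    have h3 : MeasurableSet {z : MarkSample d | r < ‖z.1 u - z.1 v‖} :=
      measurableSet_lt measurable_const (by fun_prop)
    exact h1.inter (h2.inter (h3.inter (measurableSet_graph_adj p n m u v)))
  have hcontact := prod_choiceLaw_contact_le (sampleLaw d D) t u v (Finset.range m).powerset
    (fun z => neighbours m (graph p n (m, z)) u) (measurableSet_neighbours_eq p n m u)
    (fun z => Finset.mem_powerset.mpr (neighbours_subset_range _ _ _)) G hGm
  have hcard : (((Finset.range m).erase u).erase v).card = m - 2 := by
    rw [Finset.card_erase_of_mem (by simp [hv, huv.symm]), Finset.card_erase_of_mem (by simpa),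
      Finset.card_range]
    omega
  have hmain := lintegral_longEdge_inv_degree_le hd hα p hn hθ0 hθ1 hθ hD hMn hr hβ0 hβ hγβ hβγ
    u v (((Finset.range m).erase u).erase v) (by simp) (by simp) huv
  -- Two distinct vertices below `m` force `m ≥ 2`, so truncated subtraction is harmless.
  have hm1 : (((m - 2 : ℕ) : ℝ≥0∞) + 1) = ((m - 1 : ℕ) : ℝ≥0∞) := by
    have : m - 1 = m - 2 + 1 := by omega
    rw [this]
    push_cast
    rfl
  rw [hcard, hm1, mul_assoc] at hmain
  refine hcontact.trans (le_trans ?_ hmain)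
  rw [← lintegral_indicator hGm]
  refine lintegral_mono fun z => ?_
  by_cases hz : z ∈ G
  · rw [Set.indicator_of_mem hz]
    obtain ⟨h1, h2, h3, h4⟩ := hz
    have hl : longEdge p n M r (mark z u) (mark z v) (z.2.2 s(u, v)) = 1 :=
      if_pos ⟨h2, h3, h4.2.2.2⟩
    rw [if_pos h1, hl, one_mul, one_mul]
    have := degreeIn_add_one_le_card_neighbours p n m u v z h4
    gcongr
    exact_mod_cast this
  · rw [Set.indicator_of_notMem hz]
    exact zero_le

/-! ### From short contacts to slow spreading -/

/-- If all contacts are along edges of length at most `r`, then the rumour travels a distance of at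
most `r` in each round. -/
lemma dist_le_of_mem_informed {N T : ℕ} {G : SimpleGraph ℕ} {c : ChoiceSample} {x : ℕ → Torus d}
    {r : ℝ} (hr : 0 ≤ r) {s : ℕ}
    (h : ∀ t < T, ∀ u v, G.Adj u v → contact N G c t u = v → ‖x u - x v‖ ≤ r) {t : ℕ}
    (ht : t ≤ T) :
    ∀ v ∈ informed N G c s t, (v = s ∨ v < N) ∧ ‖x v - x s‖ ≤ t * r := by
  classical
  induction t with
  | zero => simp [informed]
  | succ t ih =>
    intro v hv
    rw [informed, Finset.mem_union, Finset.mem_filter] at hv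
    rcases hv with hv | ⟨hv, u, hu, huv, hc⟩
    · obtain ⟨h1, h2⟩ := ih (by omega) v hv
      refine ⟨h1, h2.trans ?_⟩
      push_cast
      nlinarith
    · obtain ⟨-, h2⟩ := ih (by omega) u hu
      have huv' : ‖x u - x v‖ ≤ r := by
        rcases hc with hc | hc
        · exact h t (by omega) u v huv hc
        · rw [norm_sub_rev]
          exact h t (by omega) v u huv.symm hc
      refine ⟨Or.inr (Finset.mem_range.mp hv), ?_⟩
      calc ‖x v - x s‖ ≤ ‖x v - x u‖ + ‖x u - x s‖ := norm_sub_le_norm_sub_add_norm_sub _ _ _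
        _ ≤ r + t * r := by rw [norm_sub_rev (x v)]; gcongr
        _ = _ := by push_cast; ring

/-- Markov's inequality for the `γ`-th power of the weight. -/
lemma sampleLaw_weight_gt_le {D : Measure ℝ} [IsProbabilityMeasure D] {M γ : ℝ} (hM : 0 < M)
    (hγ : 0 ≤ γ) (u : ℕ) :
    sampleLaw d D {z | M < (mark z u).2} ≤
      ENNReal.ofReal (M ^ (-γ)) * ∫⁻ w, ENNReal.ofReal (w ^ γ) ∂D := by
  have h1 : sampleLaw d D {z | M < (mark z u).2} = D (Set.Ioi M) := by
    have hp : MeasurePreserving (fun z : MarkSample d => z.2.1 u) (sampleLaw d D) D :=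
      ((measurePreserving_eval_infinitePi (fun _ : ℕ => D) u).comp measurePreserving_fst).comp
        measurePreserving_snd
    exact hp.measure_preimage measurableSet_Ioi.nullMeasurableSet
  have hpos : 0 < M ^ γ := by positivity
  have h2 := meas_ge_le_lintegral_div (μ := D) (f := fun w : ℝ => ENNReal.ofReal (w ^ γ))
    (by fun_prop) (ε := ENNReal.ofReal (M ^ γ)) (by simp [hpos]) ENNReal.ofReal_ne_top
  rw [h1]
  refine (measure_mono fun w (hw : M < w) => ?_).trans (h2.trans_eq ?_)
  · exact ENNReal.ofReal_le_ofReal (Real.rpow_le_rpow hM.le hw.le hγ)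
  · rw [ENNReal.div_eq_inv_mul, Real.rpow_neg hM.le, ENNReal.ofReal_inv_of_pos hpos]

/-- The event that from some vertex the rumour reaches more than `A` vertices, given that there are
`m` vertices. -/
def fastSpread (p : ConnectionProbability d α θ₁ θ₂) (n m T : ℕ) (A : ℝ) :
    Set (MarkSample d × ChoiceSample) :=
  {ω | ∃ s < m, A < ((informed m (graph p n (m, ω.1)) ω.2 s T).card : ℝ)}

/-- A large informed set needs a heavy vertex, a long contact between light vertices, or a crowded
ball of radius `T * r` around some vertex. The first two events do not involve the start, and the
last is a union over all starts. -/
lemma fastSpread_subset (p : ConnectionProbability d α θ₁ θ₂) (n m T : ℕ) (A : ℝ) {M r : ℝ}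
    (hr : 0 ≤ r) :
    fastSpread p n m T A ⊆
      ((⋃ u ∈ Finset.range m, {z : MarkSample d | M < (mark z u).2} ×ˢ Set.univ) ∪
        ⋃ t ∈ Finset.range T, ⋃ u ∈ Finset.range m, ⋃ v ∈ (Finset.range m).erase u,
          longContact p n m M r t u v) ∪
      ⋃ s ∈ Finset.range m,
        {z : MarkSample d | A - 1 ≤ nearIn (T * r) ((Finset.range m).erase s) s z} ×ˢ Set.univ := by
  rintro ⟨z, c⟩ ⟨s, hs, hA⟩
  by_contra hnot
  simp only [Set.mem_union, not_or] at hnot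
  obtain ⟨⟨h1, h2⟩, h3⟩ := hnot
  simp only [Set.mem_iUnion, not_exists, Finset.mem_range, Set.mem_prod, Set.mem_univ, and_true,
    Finset.mem_erase] at h1 h2 h3
  have hW : ∀ u < m, (mark z u).2 ≤ M := fun u hu => not_lt.mp (h1 u hu)
  have hshort : ∀ t < T, ∀ u v, (graph p n (m, z)).Adj u v →
      contact m (graph p n (m, z)) c t u = v → ‖z.1 u - z.1 v‖ ≤ r := by
    intro t ht u v huv hc
    by_contra hlt
    have hu : u < m := huv.2.1
    have hv : v < m := huv.2.2.1
    exact h2 t ht u hu v ⟨huv.1.symm, hv⟩ ⟨⟨hW u hu, hW v hv, not_le.mp hlt, huv⟩, hc⟩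
  -- The `-1` accounts for the start itself, which `nearIn` does not count here.
  refine h3 s hs (?_ : A - 1 ≤ (nearIn (T * r) ((Finset.range m).erase s) s z : ℝ))
  have hcard : (informed m (graph p n (m, z)) c s T).card
      ≤ nearIn (T * r) ((Finset.range m).erase s) s z + 1 := by
    classical
    rw [nearIn]
    refine le_trans (Finset.card_le_card fun v hv => ?_) (Finset.card_insert_le s _)
    obtain ⟨hv1, hv2⟩ := dist_le_of_mem_informed hr hshort le_rfl v hv
    by_cases hvs : v = s
    · simp [hvs]
    · refine Finset.mem_insert_of_mem (Finset.mem_filter.mpr ⟨?_, hv2⟩)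
      exact Finset.mem_erase.mpr ⟨hvs, Finset.mem_range.mpr (hv1.resolve_left hvs)⟩
  have hcard' : ((informed m (graph p n (m, z)) c s T).card : ℝ)
      ≤ nearIn (T * r) ((Finset.range m).erase s) s z + 1 := by exact_mod_cast hcard
  dsimp only at hA
  linarith

lemma fastSpread_le (hd : 1 ≤ d) (hα : 0 < α)
    (p : ConnectionProbability d α θ₁ θ₂) {n : ℕ}
    (hn : 1 ≤ n) (hθ0 : 0 < θ₁) (hθ1 : θ₁ ≤ 1) (hθ : θ₂ ≤ 1) {D : Measure ℝ}
    [IsProbabilityMeasure D]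
    (hD : ∀ᵐ w ∂D, 1 ≤ w) {M r β γ : ℝ} (hM : 0 < M) (hMn : M ≤ n) (hr : 0 < r) (hβ0 : 0 ≤ β)
    (hβ : β ≤ α) (hγ : 0 ≤ γ)
    (hγβ : γ ≤ β) (hβγ : β - 1 ≤ γ) (m T : ℕ) (A : ℝ) :
    ((sampleLaw d D).prod choiceLaw) (fastSpread p n m T A) ≤
      (m : ℝ≥0∞) * (ENNReal.ofReal (M ^ (-γ)) * (∫⁻ w, ENNReal.ofReal (w ^ γ) ∂D) +
        T * (ENNReal.ofReal (n / θ₁ * (n * ballVolume d r) ^ (-β) * M ^ (β - γ)) *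
          (∫⁻ w, ENNReal.ofReal (w ^ γ) ∂D) ^ 2)) +
      ENNReal.ofReal (Real.exp (-(A - 1))) * ((m : ℝ≥0∞) *
        ENNReal.ofReal (1 + Real.exp 1 * (2 * (T * r)) ^ d) ^ (m - 1)) := by
  set P := (sampleLaw d D).prod choiceLaw with hP
  set X := ENNReal.ofReal (n / θ₁ * (n * ballVolume d r) ^ (-β) * M ^ (β - γ)) *
          (∫⁻ w, ENNReal.ofReal (w ^ γ) ∂D) ^ 2 with hX
  refine (measure_mono (fastSpread_subset p n m T A (M := M) hr.le)).trans ?_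
  refine (measure_union_le _ _).trans (add_le_add ((measure_union_le _ _).trans ?_) ?_)
  · rw [mul_add]
    refine add_le_add ?_ ?_
    · refine (measure_biUnion_finset_le _ _).trans ?_
      refine (Finset.sum_le_card_nsmul _ _
        (ENNReal.ofReal (M ^ (-γ)) * (∫⁻ w, ENNReal.ofReal (w ^ γ) ∂D)) fun u _ => ?_).trans_eq ?_
      · rw [hP, Measure.prod_prod, measure_univ, mul_one]
        exact sampleLaw_weight_gt_le hM hγ u
      · simp
    · refine (measure_biUnion_finset_le _ _).trans ?_
      refine (Finset.sum_le_card_nsmul _ _ (m * X) fun t _ => ?_).trans_eq ?_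
      · refine (measure_biUnion_finset_le _ _).trans ?_
        refine (Finset.sum_le_card_nsmul _ _ X fun u hu => ?_).trans_eq ?_
        · refine (measure_biUnion_finset_le _ _).trans ?_
          -- The `m - 1` possible partners `v` absorb the factor `(m - 1)⁻¹`, so the bound is linear
          -- in `m` and only the Poisson mean is needed later.
          refine (Finset.sum_le_card_nsmul _ _ (((m - 1 : ℕ) : ℝ≥0∞)⁻¹ * X) fun v hv => ?_).trans ?_
          · have hu' := Finset.mem_range.mp hu
            have hv' := Finset.mem_erase.mp hv
            exact longContact_le hd hα p hn hθ0 hθ1 hθ hD hMn hr hβ0 hβ hγβ hβγ m t u v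
              hv'.1.symm hu' (Finset.mem_range.mp hv'.2)
          · rw [Finset.card_erase_of_mem hu, Finset.card_range, nsmul_eq_mul, ← mul_assoc]
            exact mul_le_of_le_one_left zero_le (ENNReal.mul_inv_le_one _)
        · simp
      · simp only [Finset.card_range, nsmul_eq_mul]
        ring
  · refine (measure_biUnion_finset_le _ _).trans ?_
    refine (Finset.sum_le_card_nsmul _ _ (ENNReal.ofReal (Real.exp (-(A - 1))) *
        ENNReal.ofReal (1 + Real.exp 1 * (2 * (T * r)) ^ d) ^ (m - 1)) fun s hs => ?_).trans_eq ?_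
    · rw [hP, Measure.prod_prod, measure_univ, mul_one]
      have := sampleLaw_nearIn_ge_le (d := d) D (R := T * r) (by positivity) s
        ((Finset.range m).erase s) (by simp) (A - 1)
      rwa [Finset.card_erase_of_mem hs, Finset.card_range] at this
    · simp only [Finset.card_range, nsmul_eq_mul]
      ring

/-- Conditioning on the number of vertices. As an inequality, by countable subadditivity over the
sets `{m} ×ˢ B m`, it needs no measurability of `B m`. -/
lemma law_le_tsum (D : Measure ℝ) [IsProbabilityMeasure D] (n : ℕ)
    (B : ℕ → Set (MarkSample d × ChoiceSample)) :
    law d D n {ω | ((ω.1.2, ω.2) : MarkSample d × ChoiceSample) ∈ B ω.1.1} ≤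
      ∑' m, ProbabilityTheory.poissonMeasure (n : ℝ≥0) {m} *
        ((sampleLaw d D).prod choiceLaw) (B m) := by
  have h := (measurePreserving_prodAssoc (ProbabilityTheory.poissonMeasure (n : ℝ≥0))
    (sampleLaw d D) choiceLaw).measure_preimage_equiv
    {x : ℕ × MarkSample d × ChoiceSample | x.2 ∈ B x.1}
  have h' : law d D n {ω | ((ω.1.2, ω.2) : MarkSample d × ChoiceSample) ∈ B ω.1.1}
      = ((ProbabilityTheory.poissonMeasure (n : ℝ≥0)).prod ((sampleLaw d D).prod choiceLaw))
        {x : ℕ × MarkSample d × ChoiceSample | x.2 ∈ B x.1} := h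
  rw [h']
  have hsub : {x : ℕ × MarkSample d × ChoiceSample | x.2 ∈ B x.1} = ⋃ m : ℕ, {m} ×ˢ B m := by
    ext x
    simp
  rw [hsub]
  refine (measure_iUnion_le _).trans_eq (tsum_congr fun m => ?_)
  rw [Measure.prod_prod]

/-- An explicit bound for the probability that the rumour reaches more than `A` vertices in `T`
rounds. -/
lemma law_fastSpread_le (hd : 1 ≤ d) (hα : 0 < α)
    (p : ConnectionProbability d α θ₁ θ₂) {n : ℕ}
    (hn : 1 ≤ n) (hθ0 : 0 < θ₁) (hθ1 : θ₁ ≤ 1) (hθ : θ₂ ≤ 1) {D : Measure ℝ}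
    [IsProbabilityMeasure D]
    (hD : ∀ᵐ w ∂D, 1 ≤ w) {M r β γ : ℝ} (hM : 0 < M) (hMn : M ≤ n) (hr : 0 < r) (hβ0 : 0 ≤ β)
    (hβ : β ≤ α) (hγ : 0 ≤ γ)
    (hγβ : γ ≤ β) (hβγ : β - 1 ≤ γ) (T : ℕ) (A : ℝ) :
    law d D n {ω | ∃ s < numVertices ω.1, A < ((informedAfter p n ω s T).card : ℝ)} ≤
      ENNReal.ofReal (n * M ^ (-γ)) * (∫⁻ w, ENNReal.ofReal (w ^ γ) ∂D) +
      ENNReal.ofReal (n * T * (n / θ₁ * (n * ballVolume d r) ^ (-β) * M ^ (β - γ))) *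
          (∫⁻ w, ENNReal.ofReal (w ^ γ) ∂D) ^ 2 +
      ENNReal.ofReal (Real.exp (-(A - 1)) *
        (n * Real.exp (n * (Real.exp 1 * (2 * (T * r)) ^ d)))) := by
  refine (law_le_tsum D n (fun m => fastSpread p n m T A)).trans ?_
  set m₁ := ∫⁻ w, ENNReal.ofReal (w ^ γ) ∂D
  set Y := n / θ₁ * (n * ballVolume d r) ^ (-β) * M ^ (β - γ) with hY
  set b := 1 + Real.exp 1 * (2 * (T * r)) ^ d with hb
  have hb0 : 0 ≤ b := by positivity
  have hn0 : (0 : ℝ) ≤ n := by positivity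
  have h1 := lintegral_poisson_mul_pow n 1 zero_le_one
  have h2 := lintegral_poisson_mul_pow n b hb0
  simp only [ENNReal.ofReal_one, one_pow, mul_one, sub_self, mul_zero, Real.exp_zero] at h1
  calc ∑' m, ProbabilityTheory.poissonMeasure (n : ℝ≥0) {m} *
        ((sampleLaw d D).prod choiceLaw) (fastSpread p n m T A)
      ≤ ∑' m : ℕ, (ProbabilityTheory.poissonMeasure (n : ℝ≥0) {m} * (m : ℝ≥0∞) *
          (ENNReal.ofReal (M ^ (-γ)) * m₁ + T * (ENNReal.ofReal Y * m₁ ^ 2)) +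
        ProbabilityTheory.poissonMeasure (n : ℝ≥0) {m} *
          ((m : ℝ≥0∞) * ENNReal.ofReal b ^ (m - 1)) * ENNReal.ofReal (Real.exp (-(A - 1)))) := by
        refine ENNReal.tsum_le_tsum fun m => ?_
        refine (mul_le_mul_right (fastSpread_le hd hα p hn hθ0 hθ1 hθ hD hM hMn hr hβ0 hβ hγ hγβ
          hβγ m T A) _).trans_eq ?_
        ring
    _ = ENNReal.ofReal n * (ENNReal.ofReal (M ^ (-γ)) * m₁ + T * (ENNReal.ofReal Y * m₁ ^ 2)) +
        ENNReal.ofReal (n * Real.exp (n * (b - 1))) * ENNReal.ofReal (Real.exp (-(A - 1))) := by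
        rw [ENNReal.tsum_add, ENNReal.tsum_mul_right, ENNReal.tsum_mul_right, h1, h2]
    _ = _ := by
        have e1 : ENNReal.ofReal (n * T * Y) = ENNReal.ofReal n * T * ENNReal.ofReal Y := by
          rw [ENNReal.ofReal_mul (p := n * T) (by positivity), ENNReal.ofReal_mul hn0,
            ENNReal.ofReal_natCast T]
        rw [e1, ENNReal.ofReal_mul (q := M ^ (-γ)) hn0,
          ENNReal.ofReal_mul (p := Real.exp (-(A - 1))) (Real.exp_pos _).le, hb,
          add_sub_cancel_left]
        ring

/-! ### Exponents and limits -/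

/-- The choice of exponents: `β` for the bound of the connection probability, `γ` for the moment of
the weights, `n ^ μ` for the truncation of the weights and `n ^ (-κ)` for the length of edges. -/
lemma exists_exponents (d : ℕ) {τ α : ℝ} (hτ : Real.goldenRatio + 1 < τ) (hτ3 : τ < 3)
    (hα : (τ - 1) / (τ - 2) < α) :
    ∃ β γ μ κ : ℝ, 0 < β ∧ β ≤ α ∧ 0 < γ ∧ γ < τ - 1 ∧ γ ≤ β ∧ β - 1 ≤ γ ∧ μ ≤ 1 ∧ 1 < μ * γ ∧
      0 < κ ∧ κ * d < 1 ∧ 2 + κ / 2 - β * (1 - κ * d) + μ * (β - γ) < 0 := by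
  have hφ := Real.goldenRatio_sq
  have hφ1 := Real.one_lt_goldenRatio
  have hτ2 : 0 < τ - 2 := by linarith
  -- This says `τ ^ 2 - 3 * τ + 1 > 0`, whose larger root is `φ ^ 2 = φ + 1`.
  have hkey : (τ - 1) / (τ - 2) < τ := by
    rw [div_lt_iff₀ hτ2]
    nlinarith
  -- Here `τ < 3` enters; it yields `1 < β - 1 < γ < 2 < β` below.
  have h2 : 2 < (τ - 1) / (τ - 2) := by
    rw [lt_div_iff₀ hτ2]
    linarith
  obtain ⟨β, hβ1, hβ2⟩ := exists_between (lt_min hα hkey)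
  have hβα := hβ2.trans_le (min_le_left _ _)
  have hβτ := hβ2.trans_le (min_le_right _ _)
  have hβ2' : 2 < β := h2.trans hβ1
  rw [div_lt_iff₀ hτ2] at hβ1
  -- The two bounds are equivalent to `β < τ` and `(τ - 1) / (τ - 2) < β`.
  have hγ' : max (β - 1) (β / (β - 1)) < τ - 1 := by
    refine max_lt (by linarith) ?_
    rw [div_lt_iff₀ (by linarith)]
    nlinarith
  obtain ⟨γ, hγ1, hγ2⟩ := exists_between hγ'
  have hγβ1 := (le_max_left _ _).trans_lt hγ1
  have hγβ2 := (le_max_right _ _).trans_lt hγ1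
  rw [div_lt_iff₀ (by linarith)] at hγβ2
  have hγ0 : 1 < γ := by linarith
  have hγβ : γ < β := by linarith
  -- The upper bound on `μ` makes the final exponent negative at `κ = 0`; compatibility with `1 / γ`
  -- amounts to `β < γ * (β - 1)`.
  have hμ' : 1 / γ < min 1 ((β - 2) / (β - γ)) := by
    refine lt_min ?_ ?_
    · rw [div_lt_one (by linarith)]
      exact hγ0
    · rw [div_lt_div_iff₀ (by linarith) (by linarith)]
      nlinarith
  obtain ⟨μ, hμ1, hμ2⟩ := exists_between hμ'
  have hμ3 := hμ2.trans_le (min_le_right _ _)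
  rw [lt_div_iff₀ (by linarith)] at hμ3
  rw [div_lt_iff₀ (by linarith)] at hμ1
  -- The slack at `κ = 0`. Taking `κ = ε / (1 + β * d)` keeps the loss `κ / 2 + β * κ * d` below it,
  -- and the cap `1 / 2` secures `κ * d < 1`.
  set ε := min (1 / 2) (β - 2 - μ * (β - γ)) with hε
  have hε0 : 0 < ε := lt_min (by norm_num) (by linarith)
  have hε1 : ε ≤ 1 / 2 := min_le_left _ _
  have hε2 : ε ≤ β - 2 - μ * (β - γ) := min_le_right _ _
  have hd0 : (0 : ℝ) ≤ d := by positivity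
  have hden : 0 < 1 + β * d := by positivity
  refine ⟨β, γ, μ, ε / (1 + β * d), by linarith, hβα.le, by linarith, hγ2, hγβ.le, hγβ1.le,
    (hμ2.trans_le (min_le_left _ _)).le, hμ1, by positivity, ?_, ?_⟩
  · rw [div_mul_eq_mul_div, div_lt_one hden]
    nlinarith
  · have h1 : ε / (1 + β * d) / 2 + β * (ε / (1 + β * d) * d) < ε := by
      have h2 : ε / (1 + β * d) + β * (ε / (1 + β * d) * d) = ε := by field_simp
      have h3 : 0 < ε / (1 + β * d) := by positivity
      linarith
    linarith

lemma tendsto_mul_exp_one_sub_rpow {δ : ℝ} (hδ : 0 < δ) :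
    Tendsto (fun n : ℕ => (n : ℝ) * Real.exp (1 - (n : ℝ) ^ δ)) atTop (𝓝 0) := by
  have h1 := (tendsto_rpow_mul_exp_neg_mul_atTop_nhds_zero (1 / δ) 1 one_pos).comp
    ((tendsto_rpow_atTop hδ).comp tendsto_natCast_atTop_atTop)
  have h2 := h1.const_mul (Real.exp 1)
  rw [mul_zero] at h2
  refine h2.congr fun n => ?_
  simp only [Function.comp_apply]
  rw [← Real.rpow_mul (by positivity), mul_one_div_cancel hδ.ne', Real.rpow_one, sub_eq_add_neg,
    Real.exp_add]
  ring_nf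

lemma tendsto_natCast_rpow_of_neg {e : ℝ} (he : e < 0) :
    Tendsto (fun n : ℕ => (n : ℝ) ^ e) atTop (𝓝 0) := by
  have h := (tendsto_rpow_neg_atTop (y := -e) (by linarith)).comp tendsto_natCast_atTop_atTop
  simpa [Function.comp_def] using h

end GIRG

/-! ### The main theorem -/

open GIRG in
/-- Slow rumour spreading in Euclidean GIRGs. The bound holds, with probability tending to one,
for all starting vertices `s` simultaneously. -/
theorem theorem2p3 (d : ℕ) (hd : 1 ≤ d) (τ α : ℝ)
    (hτ : Real.goldenRatio + 1 < τ) (hτ3 : τ < 3) (hα : (τ - 1) / (τ - 2) < α) :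
    ∃ ρ₁ ρ₂ : ℝ, 0 < ρ₁ ∧ 0 < ρ₂ ∧
      ∀ θ₁ θ₂ : ℝ, 0 < θ₁ → θ₁ ≤ θ₂ → θ₂ ≤ 1 →
      ∀ (D : Measure ℝ) [IsProbabilityMeasure D], GIRG.IsPowerLaw τ D →
      ∀ p : GIRG.ConnectionProbability d α θ₁ θ₂,
      ∃ C : ℝ, 0 < C ∧
        Tendsto (fun n : ℕ => GIRG.law d D n
          {ω | ∃ s < GIRG.numVertices ω.1,
            C * (n : ℝ) ^ (1 - ρ₁) < ((GIRG.informedAfter p n ω s ⌊(n : ℝ) ^ ρ₂⌋₊).card : ℝ)})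
          atTop (𝓝 0) := by
  obtain ⟨β, γ, μ, κ, hβ0, hβα, hγ0, hγτ, hγβ, hβγ, hμ1, hμγ, hκ0, hκd, hexp⟩ :=
    exists_exponents d hτ hτ3 hα
  have hd0 : (0 : ℝ) < d := by exact_mod_cast hd
  -- With `n ^ (κ / 2)` rounds and steps of length `n ^ (-κ)`, the rumour covers a distance at most
  -- `n ^ (-κ / 2)`; such a ball has volume of order `n ^ (-κ * d / 2)`.
  refine ⟨κ * d / 2, κ / 2, by positivity, by positivity, ?_⟩
  intro θ₁ θ₂ hθ0 hθ12 hθ2 D _ hD p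
  set B : ℝ := Real.exp 1 * 2 ^ d with hB
  set δ : ℝ := 1 - κ * d / 2 with hδ
  set m₁ := ∫⁻ w, ENNReal.ofReal (w ^ γ) ∂D with hm₁
  have hm₁top : m₁ ≠ ∞ := (hD.lintegral_rpow_lt_top hγ0.le hγτ).ne
  set E : ℝ := 2 + κ / 2 - β * (1 - κ * d) + μ * (β - γ) with hE
  -- The Chernoff bound costs `exp (B * n ^ δ)`; the additional `1` leaves the decay `exp (-n ^ δ)`,
  -- which beats the factor `n` from the choice of the start.
  refine ⟨B + 1, by positivity, ?_⟩
  have hlim : Tendsto (fun n : ℕ => ENNReal.ofReal ((n : ℝ) ^ (1 - μ * γ)) * m₁ +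
      ENNReal.ofReal (θ₁⁻¹ * (n : ℝ) ^ E) * m₁ ^ 2 +
      ENNReal.ofReal ((n : ℝ) * Real.exp (1 - (n : ℝ) ^ δ))) atTop (𝓝 0) := by
    have t1 := ENNReal.Tendsto.mul_const (b := m₁) (ENNReal.tendsto_ofReal
      (tendsto_natCast_rpow_of_neg (e := 1 - μ * γ) (by linarith))) (Or.inr hm₁top)
    have t2 := ENNReal.Tendsto.mul_const (b := m₁ ^ 2) (ENNReal.tendsto_ofReal
      ((tendsto_natCast_rpow_of_neg hexp).const_mul θ₁⁻¹)) (Or.inr (ENNReal.pow_ne_top hm₁top))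
    have t3 := ENNReal.tendsto_ofReal (tendsto_mul_exp_one_sub_rpow (δ := δ) (by linarith))
    simpa using (t1.add t2).add t3
  refine tendsto_of_tendsto_of_tendsto_of_le_of_le' tendsto_const_nhds hlim
    (Eventually.of_forall fun _ => zero_le) ?_
  filter_upwards [eventually_ge_atTop 1] with n hn
  have hn1 : (1 : ℝ) ≤ n := by exact_mod_cast hn
  have hn0 : (0 : ℝ) < n := by linarith
  have hα0 : 0 < α := hβ0.trans_le hβα
  set T := ⌊(n : ℝ) ^ (κ / 2)⌋₊ with hT
  have hTle : (T : ℝ) ≤ (n : ℝ) ^ (κ / 2) := Nat.floor_le (by positivity)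
  set r := (n : ℝ) ^ (-κ) with hr
  have hr0 : 0 < r := by positivity
  have hr1 : r ≤ 1 := Real.rpow_le_one_of_one_le_of_nonpos hn1 (by linarith)
  have hMn : (n : ℝ) ^ μ ≤ n := by
    calc (n : ℝ) ^ μ ≤ (n : ℝ) ^ (1 : ℝ) := Real.rpow_le_rpow_of_exponent_le hn1 hμ1
      _ = n := Real.rpow_one _
  refine (law_fastSpread_le hd hα0 p hn hθ0 (hθ12.trans hθ2) hθ2 hD.ae_one_le
    (M := (n : ℝ) ^ μ) (r := r) (by positivity) hMn hr0 hβ0.le hβα hγ0.le hγβ hβγ T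
    ((B + 1) * (n : ℝ) ^ δ)).trans ?_
  refine add_le_add (add_le_add ?_ ?_) ?_
  · gcongr
    rw [← Real.rpow_mul hn0.le, ← Real.rpow_one_add' hn0.le (by linarith)]
    exact (congrArg _ (by ring)).le
  · gcongr ENNReal.ofReal ?_ * _
    have hV0 := ballVolume_pos d hr0
    have hV : (n : ℝ) ^ (-(κ * d)) ≤ ballVolume d r := by
      rw [ballVolume_eq d hr0.le]
      calc (n : ℝ) ^ (-(κ * d)) = r ^ d := by
            rw [hr, ← Real.rpow_natCast, ← Real.rpow_mul hn0.le]
            congr 1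
            ring
        _ ≤ _ := by
          gcongr
          exact le_min hr1 (by linarith)
    have hK : (n * ballVolume d r) ^ (-β) ≤ (n : ℝ) ^ (-(β * (1 - κ * d))) := by
      have h1 : (n : ℝ) ^ (1 - κ * d) ≤ n * ballVolume d r := by
        calc (n : ℝ) ^ (1 - κ * d) = n * (n : ℝ) ^ (-(κ * d)) := by
              rw [sub_eq_add_neg, Real.rpow_add hn0, Real.rpow_one]
          _ ≤ _ := by gcongr
      refine (Real.rpow_le_rpow_of_nonpos (by positivity) h1 (by linarith)).trans_eq ?_
      rw [← Real.rpow_mul hn0.le]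
      congr 1
      ring
    calc n * T * (n / θ₁ * (n * ballVolume d r) ^ (-β) * ((n : ℝ) ^ μ) ^ (β - γ))
        ≤ n * (n : ℝ) ^ (κ / 2) * (n / θ₁ * (n : ℝ) ^ (-(β * (1 - κ * d))) *
          ((n : ℝ) ^ μ) ^ (β - γ)) := by gcongr
      _ = θ₁⁻¹ * ((n : ℝ) ^ (2 : ℝ) * (n : ℝ) ^ (κ / 2) * (n : ℝ) ^ (-(β * (1 - κ * d))) *
          (n : ℝ) ^ (μ * (β - γ))) := by
          rw [Real.rpow_two, Real.rpow_mul hn0.le]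
          ring
      _ = θ₁⁻¹ * (n : ℝ) ^ E := by
          rw [← Real.rpow_add hn0, ← Real.rpow_add hn0, ← Real.rpow_add hn0, hE]
          ring_nf
  · refine ENNReal.ofReal_le_ofReal ?_
    have hball : n * (Real.exp 1 * (2 * (T * r)) ^ d) ≤ B * (n : ℝ) ^ δ := by
      have h1 : T * r ≤ (n : ℝ) ^ (-(κ / 2)) := by
        calc T * r ≤ (n : ℝ) ^ (κ / 2) * (n : ℝ) ^ (-κ) := by gcongr
          _ = (n : ℝ) ^ (-(κ / 2)) := by
            rw [← Real.rpow_add hn0]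
            ring_nf
      calc n * (Real.exp 1 * (2 * (T * r)) ^ d)
          ≤ n * (Real.exp 1 * (2 * (n : ℝ) ^ (-(κ / 2))) ^ d) := by gcongr
        _ = B * (n * (n : ℝ) ^ (-(κ * d / 2))) := by
          rw [mul_pow, ← Real.rpow_natCast ((n : ℝ) ^ (-(κ / 2))), ← Real.rpow_mul hn0.le, hB]
          ring_nf
        _ = B * (n : ℝ) ^ δ := by
          rw [hδ, sub_eq_add_neg, Real.rpow_add hn0, Real.rpow_one]
    calc Real.exp (-((B + 1) * (n : ℝ) ^ δ - 1)) *
          (n * Real.exp (n * (Real.exp 1 * (2 * (T * r)) ^ d)))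
        ≤ Real.exp (-((B + 1) * (n : ℝ) ^ δ - 1)) * (n * Real.exp (B * (n : ℝ) ^ δ)) := by gcongr
      _ = n * Real.exp (1 - (n : ℝ) ^ δ) := by
        rw [mul_left_comm, ← Real.exp_add]
        ring_nf
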